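/- A two-tape DFA $R=(Q,\Gamma\times\Gamma,q_\varepsilon,\delta,F)$ recognises the relation $L(R)$ of all pairs of words $\tau,\tau'\in\Gamma^*$ of equal length whose letterwise pairing is accepted; its size $|R|$ is its number of transitions, $|Q|\cdot|\Gamma|^2$. An equivalence relation $\sim$ on $\Gamma^*$ is an *indistinguishability relation* if related words have the same length and equally long prefixes of related words are related. Its *information tree* has the $\sim$-classes as nodes and an edge from $[\tau]_\sim$ to $[\tau c]_\sim$ for all $\tau\in\Gamma^*$, $c\in\Gamma$; it has *bounded branching* if some finite number bounds the number of successors of every node. A Mealy automaton $M=(P,\Gamma,\Sigma,p_\varepsilon,\delta_M,\lambda)$ with $P,\Sigma$ finite has size $|P|\cdot|\Gamma|$ and defines the observation function $\beta_M:\Gamma^+\to\Sigma$, $\beta_M(\tau c)=\lambda(\delta_M(p_\varepsilon,\tau),c)$; put $\hat\beta_M(c_1\ldots c_\ell)=\beta_M(c_1)\,\beta_M(c_1c_2)\cdots\beta_M(c_1\ldots c_\ell)$. For a two-tape DFA $R$ over a linearly ordered alphabet with $\sim\;=L(R)$, identify states of $R$ that accept the same language, and let $\delta(\tau,\tau')$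 be the resulting state (of the minimised automaton) reached from $q_\varepsilon$ on the pair $(\tau,\tau')$. Write $\tau\approx\tau'$ if $|\tau|=|\tau'|$ and $\delta(\tau,\pi)=\delta(\tau',\pi)$ for all $\pi$ of that length. Let $w_1<\dots<w_d$ be the lexicographically least elements of the $\approx$-classes contained in $[\tau]_\sim$; $\mathrm{mat}(\tau)$ is the $d\times d$ matrix with entries $\delta(w_i,w_j)$, and $\mathrm{ind}(\tau)$ is the $i$ with $w_i\approx\tau$. **Theorem.** There are a constant $C$ and an algorithm (a computable function on descriptions of finite automata) that, given any two-tape DFA $R$ (over an alphabet $\Gamma=\{0,\ldots,k-1\}$, with states $\{0,\ldots,n-1\}$) such that $L(R)$ is an indistinguishability relation whose information tree has bounded branching, outputs a Mealy automaton $M=(P,\Gamma,\Sigma,p_\varepsilon,\delta_M,\lambda)$ such that 1. the size of $M$ is at most $2^{2^{2^{C|R|^2}}}$; 2. $M$ defines an observation function equivalent to $R$: for all $\tau,\tau'\in\Gamma^*$, $(\tau,\tau')\in L(R)$ if and only if $\hat\beta_M(\tau)=\hat\beta_M(\tau')$; 3. up to renaming, the states of $M$ are the pairs $(\mathrm{mat}(\tau),\mathrm{ind}(\tau))$,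 $\tau\in\Gamma^*$, the state reached on $\tau$ being $(\mathrm{mat}(\tau),\mathrm{ind}(\tau))$; 4. $x_{p,a}:=\lambda(p,a)$ is a solution of (so, in particular, there is a solution of) the following system of constraints in variables $x_{p,a}$ ($p\in P$, $a\in\Gamma$): for all $\tau,\tau'$ with $(\tau,\tau')\in L(R)$ leading $M$ to $p,p'$ respectively, and all $a,b\in\Gamma$, $x_{p,a}=x_{p',b}$ if $(\tau a,\tau' b)\in L(R)$, and $x_{p,a}\ne x_{p',b}$ otherwise. -/

import Mathlib

namespace InfoAutomata

/-! ### Two-tape automata, indistinguishability relations, information trees -/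

/-- The synchronous relation recognised by a two-tape DFA: all pairs of words of the same length
whose letterwise pairing is accepted. -/
def recognisedRel {Γ Q : Type*} (R : DFA (Γ × Γ) Q) (τ τ' : List Γ) : Prop :=
  τ.length = τ'.length ∧ τ.zip τ' ∈ R.accepts

/-- An indistinguishability relation: an equivalence relation on histories whose classes satisfy
synchronous perfect recall. -/
structure IsIndistinguishability {Γ : Type*} (r : List Γ → List Γ → Prop) : Prop where
  equivalence : Equivalence r
  length_eq : ∀ τ τ', r τ τ' → τ.length = τ'.length
  perfectRecall : ∀ τ τ', r τ τ' → ∀ t, t ≤ τ.length → r (τ.take t) (τ'.take t)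

/-- The partition of the histories into information sets. -/
def IsIndistinguishability.setoid {Γ : Type*} {r : List Γ → List Γ → Prop}
    (h : IsIndistinguishability r) : Setoid (List Γ) where
  r := r
  iseqv := h.equivalence

/-- The successors of an information set `U` in the information tree: the information sets that
contain some `τ ++ [c]` with `τ` in `U`. -/
def treeSuccessors {Γ : Type*} (s : Setoid (List Γ)) (U : Quotient s) : Set (Quotient s) :=
  {U' | ∃ (τ : List Γ) (c : Γ), Quotient.mk s τ = U ∧ Quotient.mk s (τ ++ [c]) = U'}

/-- The information tree has bounded branching: some finite number bounds the number of successors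
of every information set. -/
def BoundedBranching {Γ : Type*} (s : Setoid (List Γ)) : Prop :=
  ∃ b : ℕ, ∀ U : Quotient s, (treeSuccessors s U).encard ≤ b

/-- The size of a two-tape DFA is the number of its transitions. -/
def dfaSize {Γ Q : Type*} [Fintype Γ] [Fintype Q] (_ : DFA (Γ × Γ) Q) : ℕ :=
  Fintype.card Q * Fintype.card (Γ × Γ)

/-! ### Mealy automata and observation functions -/

/-- Mealy automata with states `P`, input alphabet `Γ` and output alphabet `S`. -/
structure Mealy (Γ S P : Type*) where
  start : P
  step : P → Γ → P
  output : P → Γ → S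

namespace Mealy

variable {Γ S P : Type*}

/-- The state reached from the initial state on reading a word. -/
def eval (M : Mealy Γ S P) (τ : List Γ) : P :=
  τ.foldl M.step M.start

/-- The observation function defined by a Mealy automaton; its value at the nonempty history
`τ ++ [c]` is written as the value at `τ` and `c`. -/
def observation (M : Mealy Γ S P) (τ : List Γ) (c : Γ) : S :=
  M.output (M.eval τ) c

/-- The size of a Mealy automaton is the number of its transitions. -/
def size [Fintype Γ] [Fintype P] (_ : Mealy Γ S P) : ℕ :=
  Fintype.card P * Fintype.card Γ

end Mealy

/-- The sequence of the observations made along a history `c₁ c₂ … c_ℓ`, that is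
`β(c₁), β(c₁c₂), …, β(c₁ … c_ℓ)`. -/
def observationHistory {Γ S : Type*} (β : List Γ → Γ → S) (τ : List Γ) : List S :=
  List.ofFn fun t : Fin τ.length => β (τ.take t) (τ.get t)

/-! ### Matrices and indices of histories -/

/-- Two states of a DFA are identified by minimisation if they accept the same language. -/
def stateSetoid {α Q : Type*} (R : DFA α Q) : Setoid Q where
  r q q' := R.acceptsFrom q = R.acceptsFrom q'
  iseqv := ⟨fun _ => rfl, fun h => h.symm, fun h h' => h.trans h'⟩

/-- The states of a DFA after minimisation. -/
abbrev MinState {α Q : Type*} (R : DFA α Q) : Type _ :=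
  Quotient (stateSetoid R)

/-- The state that the minimised two-tape DFA reaches on a pair of words of the same length. -/
def pairState {Γ Q : Type*} (R : DFA (Γ × Γ) Q) (τ τ' : List Γ) : MinState R :=
  Quotient.mk (stateSetoid R) (R.eval (τ.zip τ'))

/-- Two histories of the same length are interchangeable if the minimised automaton reaches the
same state on each of them when paired with any history of that length. -/
def Interchangeable {Γ Q : Type*} (R : DFA (Γ × Γ) Q) (τ τ' : List Γ) : Prop :=
  τ.length = τ'.length ∧
    ∀ π : List Γ, π.length = τ.length → pairState R τ π = pairState R τ' π

/-- The lexicographically least members of the interchangeability classes that make up the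
information set of `τ`. -/
def classMinima {Γ Q : Type*} [LinearOrder Γ] (R : DFA (Γ × Γ) Q) (τ : List Γ) : Set (List Γ) :=
  {ρ | recognisedRel R τ ρ ∧ ∀ ρ', Interchangeable R ρ' ρ → ρ ≤ ρ'}

/-- A square matrix together with the index of one of its columns. -/
structure IndexedMatrix (A : Type*) where
  dim : ℕ
  matrix : Matrix (Fin dim) (Fin dim) A
  index : Fin dim

/-- `X` consists of the matrix and the index of the history `τ`: list the interchangeability
classes contained in the information set of `τ` in the order of their lexicographically least
members `w 0 < w 1 < …`; the `(i, j)` entry is the state reached on `(w i, w j)`, and the index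
is the place of the class of `τ` in this list. -/
def IsIndexedMatrixOf {Γ Q : Type*} [LinearOrder Γ] (R : DFA (Γ × Γ) Q) (τ : List Γ)
    (X : IndexedMatrix (MinState R)) : Prop :=
  ∃ w : Fin X.dim → List Γ, StrictMono w ∧ Set.range w = classMinima R τ ∧
    (∀ i j, X.matrix i j = pairState R (w i) (w j)) ∧ Interchangeable R (w X.index) τ

/-! ### The constraints on the outputs -/

/-- The state `((p₁, p₂), q)` is reachable in the product of two parallel copies of (the
semi-automaton of) `M` with the two-tape DFA `R`. -/
def ProductReachable {Γ S P Q : Type*} (R : DFA (Γ × Γ) Q) (M : Mealy Γ S P) (p₁ p₂ : P) (q : Q) :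
    Prop :=
  ∃ τ τ' : List Γ, τ.length = τ'.length ∧ M.eval τ = p₁ ∧ M.eval τ' = p₂ ∧ R.eval (τ.zip τ') = q

/-- An assignment of values to the variables `x (p, a)`, for the states `p` of `M` and the letters
`a`, solves the system of constraints that has, for every reachable state `((p₁, p₂), q)` of the
product with `q` accepting and all letters `a`, `b`, the equality `x (p₁, a) = x (p₂, b)` if the
transition of `R` from `q` on `(a, b)` leads to an accepting state, and the disequality
`x (p₁, a) ≠ x (p₂, b)` otherwise. -/
def SolvesConstraints {Γ S P Q X : Type*} (R : DFA (Γ × Γ) Q) (M : Mealy Γ S P) (x : P × Γ → X) :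
    Prop :=
  ∀ (p₁ p₂ : P) (q : Q), ProductReachable R M p₁ p₂ q → q ∈ R.accept → ∀ a b : Γ,
    (R.step q (a, b) ∈ R.accept → x (p₁, a) = x (p₂, b)) ∧
    (R.step q (a, b) ∉ R.accept → x (p₁, a) ≠ x (p₂, b))

/-! ### Automata as finite data -/

/-- Descriptions of two-tape DFAs: number of letters, number of states, initial state, acceptance
of each state, and the transition table (by state, first letter, second letter). -/
abbrev DFACode : Type :=
  ℕ × ℕ × ℕ × List Bool × List (List (List ℕ))

open Classical in
/-- The description of a two-tape DFA with letters `0, …, k - 1` and states `0, …, n - 1`. -/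
noncomputable def dfaCode {k n : ℕ} (R : DFA (Fin k × Fin k) (Fin n)) : DFACode :=
  (k, n, (R.start : ℕ), (List.finRange n).map (fun q => decide (q ∈ R.accept)),
    (List.finRange n).map fun q => (List.finRange k).map fun a => (List.finRange k).map fun b =>
      ((R.step q (a, b) : Fin n) : ℕ))

/-- Descriptions of Mealy automata: number of letters, number of output symbols, number of states,
initial state, transition table and output table (by state and letter). -/
abbrev MealyCode : Type :=
  ℕ × ℕ × ℕ × ℕ × List (List ℕ) × List (List ℕ)

/-- The description of a Mealy automaton with letters `0, …, k - 1`, output symbols `0, …, s - 1`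
and states `0, …, N - 1`. -/
def mealyCode {k s N : ℕ} (M : Mealy (Fin k) (Fin s) (Fin N)) : MealyCode :=
  (k, s, N, (M.start : ℕ),
    (List.finRange N).map (fun p => (List.finRange k).map fun a => ((M.step p a : Fin N) : ℕ)),
    (List.finRange N).map fun p => (List.finRange k).map fun a => ((M.output p a : Fin s) : ℕ))

end InfoAutomata

open InfoAutomata

/-! Let `∼` be the relation recognised by `R`, with `n` states and `k` letters.

**Interchangeability is tested on the diagonal.** For words of the same length, `τ ≈ τ'` holds iff
`τ u ∼ τ' u` for all `u` (`interchangeable_iff`). So `≈` is a right congruence, and whether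
`τ ≈ τ'` depends only on the state of the minimised automaton on `(τ, τ')`.

**The indexed matrix of `τ a` is a function of that of `τ` and of `a`**
(`IsIndexedMatrixOf.concat`). The lexicographically least members of the `≈`-classes are closed
under prefixes, so those below `[τ a]` are one-letter extensions `w i b` of those in `[τ]`. Which
extensions occur, their order, and the states on pairs of them can be read off the matrix and the
index. Hence the indexed matrices are the states of a deterministic automaton. Let the output at
`(τ, a)` be the first pair `(i, b)` with `w i b ∼ τ a`. Histories in the same information set have
the same list `w`, so this solves the constraints, and by perfect recall any solution of the
constraints makes the observation histories agree exactly on related histories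
(`SolvesConstraints.recognisedRel_iff`).

**The number of `≈`-classes in an information set is at most doubly exponential.** It is bounded by
some number because two members that are not interchangeable are separated by a common extension
shorter than `n`, and an information set has boundedly many descendants at each depth
(`exists_ncard_classMinima_le`). To make the bound explicit, the pairs of `τ` and a least member in
`[τ]` are recognised by a deterministic two-tape automaton with `m = n ^ 2 * 2 ^ n` states: besides
the states of `R` on `(τ, v)` and `(v, v)`, it records the set of states of `R` on the pairs
`(v', v)` with `v' < v` (`minimaAutomaton`). Read as an automaton on the first tape that guesses the
second one, it is finitely ambiguous, and for a fixed alphabet a finitely ambiguous automaton with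
`m` states has at most `2 ^ p` runs on a word, where `p` is of order `m ^ 2`
(`BoundedRuns.entry_le`). Indeed, inside a strongly connected component runs are unique, since two
of them could be pumped to `2 ^ N`; and a transition that leaves a component is used at no more than
`4 ^ m` positions, since between two positions with the same sets of reachable and of productive
states the word could be pumped to give `N` runs. This makes the number of indexed matrices triply
exponential in `n k ^ 2`.

**Computability.** Each indexed matrix occurs at a word no longer than this bound, so the states
can be found by listing all words up to it. With words coded as numbers in base `k`, every notion
involved is a bounded quantification or a filtered list, and the construction is primitive
recursive; equivalence of states is decided by the words of length at most `n ^ 2`. -/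

namespace InfoAutomata

/-! ### Finitely ambiguous products of natural matrices -/

section Ambiguity

lemma mul_entry_pos_iff {Q : Type*} [Fintype Q] (A B : Matrix Q Q ℕ) (p q : Q) :
    0 < (A * B) p q ↔ ∃ r, 0 < A p r ∧ 0 < B r q := by
  simp only [Matrix.mul_apply, Finset.sum_pos_iff, Finset.mem_univ, true_and]
  exact exists_congr fun r => CanonicallyOrderedAdd.mul_pos

lemma entry_mul_entry_le {Q : Type*} [Fintype Q] (A B : Matrix Q Q ℕ) (p q r : Q) :
    A p q * B q r ≤ (A * B) p r := by
  rw [Matrix.mul_apply]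
  exact Finset.single_le_sum (f := fun q => A p q * B q r) (fun _ _ => Nat.zero_le _)
    (Finset.mem_univ q)

variable {α Q : Type*} [Fintype Q] [DecidableEq Q] (M : α → Matrix Q Q ℕ)

/-- The product of the matrices of the letters of a word. Read as a transition count, its
`(p, q)` entry is the number of runs from `p` to `q` on the word. -/
def wordMatrix (τ : List α) : Matrix Q Q ℕ :=
  (τ.map M).prod

/-- Some word has a run from `p` to `q`. -/
def Reaches (p q : Q) : Prop :=
  ∃ τ : List α, 0 < wordMatrix M τ p q

/-- The number of runs from `p` to `q` is bounded uniformly in the word. -/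
def BoundedRuns (p q : Q) : Prop :=
  ∃ B : ℕ, ∀ τ : List α, wordMatrix M τ p q ≤ B

@[simp] lemma wordMatrix_nil : wordMatrix M [] = 1 := rfl

lemma wordMatrix_cons (a : α) (τ : List α) :
    wordMatrix M (a :: τ) = M a * wordMatrix M τ := by
  simp [wordMatrix]

lemma wordMatrix_singleton (a : α) : wordMatrix M [a] = M a := by
  simp [wordMatrix]

lemma wordMatrix_append (τ τ' : List α) :
    wordMatrix M (τ ++ τ') = wordMatrix M τ * wordMatrix M τ' := by
  simp [wordMatrix]

lemma Reaches.refl (p : Q) : Reaches M p p := ⟨[], by simp⟩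

variable {M}

lemma Reaches.trans {p q r : Q} (h : Reaches M p q) (h' : Reaches M q r) : Reaches M p r := by
  obtain ⟨τ, hτ⟩ := h
  obtain ⟨τ', hτ'⟩ := h'
  refine ⟨τ ++ τ', ?_⟩
  rw [wordMatrix_append, mul_entry_pos_iff]
  exact ⟨q, hτ, hτ'⟩

lemma BoundedRuns.of_reaches {s f p q : Q} (h : BoundedRuns M s f) (hp : Reaches M s p)
    (hq : Reaches M q f) : BoundedRuns M p q := by
  obtain ⟨B, hB⟩ := h
  obtain ⟨x, hx⟩ := hp
  obtain ⟨y, hy⟩ := hq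
  refine ⟨B, fun τ => ?_⟩
  calc wordMatrix M τ p q ≤ wordMatrix M x s p * wordMatrix M τ p q := Nat.le_mul_of_pos_left _ hx
    _ ≤ wordMatrix M (x ++ τ) s q := by
        rw [wordMatrix_append]; exact entry_mul_entry_le ..
    _ ≤ wordMatrix M (x ++ τ) s q * wordMatrix M y q f := Nat.le_mul_of_pos_right _ hy
    _ ≤ wordMatrix M (x ++ τ ++ y) s f := by
        rw [wordMatrix_append M (x ++ τ) y]; exact entry_mul_entry_le ..
    _ ≤ B := hB _

/-- Two runs from `p` to `p` on the same word would give `2 ^ N` runs on its `N`-th power. -/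
lemma BoundedRuns.entry_self_le_one {p : Q} (h : BoundedRuns M p p) (τ : List α) :
    wordMatrix M τ p p ≤ 1 := by
  obtain ⟨B, hB⟩ := h
  by_contra! hlt
  have key : ∀ N : ℕ, 2 ^ N ≤ wordMatrix M (List.replicate N τ).flatten p p := by
    intro N
    induction N with
    | zero => simp
    | succ N ih =>
      rw [List.replicate_succ, List.flatten_cons, wordMatrix_append]
      calc 2 ^ (N + 1) = 2 * 2 ^ N := by ring
        _ ≤ _ := Nat.mul_le_mul hlt ih
        _ ≤ _ := entry_mul_entry_le ..
  exact absurd ((key B).trans (hB _)) (not_le.2 B.lt_two_pow_self)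

lemma BoundedRuns.entry_le_one {p q : Q} (h : BoundedRuns M p p) (hq : Reaches M q p)
    (τ : List α) : wordMatrix M τ p q ≤ 1 := by
  obtain ⟨y, hy⟩ := hq
  calc wordMatrix M τ p q ≤ wordMatrix M τ p q * wordMatrix M y q p :=
        Nat.le_mul_of_pos_right _ hy
    _ ≤ wordMatrix M (τ ++ y) p p := by
        rw [wordMatrix_append]; exact entry_mul_entry_le ..
    _ ≤ 1 := h.entry_self_le_one _

/-- Suppose that reading `c :: u` after `x` changes neither the set of states that can be reached
nor the set of states from which `y` leads to `f`, and that runs on `x ++ c :: (u ++ y)` can step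
from `p'` to `q'` at the letter `c`, where `q'` does not reach `p'`. In the word `x (c u) ^ N y`
this step can be taken in any of the `N` copies of `c u`, which yields `N` different runs. -/
lemma not_boundedRuns_of_pump {p f p' q' : Q} {x u y : List α} {c : α}
    (hS : ∀ s, 0 < wordMatrix M (x ++ c :: u) p s ↔ 0 < wordMatrix M x p s)
    (hE : ∀ e, 0 < wordMatrix M (c :: u ++ y) e f ↔ 0 < wordMatrix M y e f)
    (hp' : 0 < wordMatrix M x p p') (hc : 0 < M c p' q')
    (hq' : 0 < wordMatrix M (u ++ y) q' f) (hr : ¬ Reaches M q' p') :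
    ¬ BoundedRuns M p f := by
  classical
  rintro ⟨B, hB⟩
  let A : ℕ → Matrix Q Q ℕ := fun N => wordMatrix M (x ++ (List.replicate N (c :: u)).flatten)
  have A_succ : ∀ N, A (N + 1) = A N * wordMatrix M (c :: u) := by
    intro N
    simp only [A]
    rw [List.replicate_succ', List.flatten_append, ← List.append_assoc, wordMatrix_append]
    simp
  have A_zero : A 0 = wordMatrix M x := by simp [A]
  have A_pos : ∀ N s, 0 < A N p s ↔ 0 < wordMatrix M x p s := by
    intro N
    induction N with
    | zero => intro s; rw [A_zero]
    | succ N ih =>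
      intro s
      rw [A_succ, mul_entry_pos_iff, ← hS s, wordMatrix_append, mul_entry_pos_iff]
      simp only [ih]
  -- the states from which the run can be completed but `p'` can no longer be reached
  let E : Finset Q := {e | 0 < wordMatrix M y e f ∧ ¬ Reaches M e p'}
  have p'_notMem : p' ∉ E := fun h => (Finset.mem_filter.1 h).2.2 (Reaches.refl M p')
  have step_E : ∀ e, e ∈ E → ∃ e' ∈ E, 0 < wordMatrix M (c :: u) e e' := by
    intro e he
    obtain ⟨h1, h2⟩ := (Finset.mem_filter.1 he).2
    rw [← hE e, wordMatrix_append, mul_entry_pos_iff] at h1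
    obtain ⟨e', he', h1⟩ := h1
    refine ⟨e', ?_, he'⟩
    simp only [E, Finset.mem_filter, Finset.mem_univ, true_and]
    exact ⟨h1, fun h => h2 (Reaches.trans ⟨_, he'⟩ h)⟩
  have step_p' : ∃ e' ∈ E, 0 < wordMatrix M (c :: u) p' e' := by
    rw [wordMatrix_append, mul_entry_pos_iff] at hq'
    obtain ⟨e', he', h1⟩ := hq'
    refine ⟨e', ?_, ?_⟩
    · simp only [E, Finset.mem_filter, Finset.mem_univ, true_and]
      exact ⟨h1, fun h => hr (Reaches.trans ⟨_, he'⟩ h)⟩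
    · rw [wordMatrix_cons, mul_entry_pos_iff]
      exact ⟨q', hc, he'⟩
  have step_sum : ∀ s ∈ insert p' E, 1 ≤ ∑ e' ∈ E, wordMatrix M (c :: u) s e' := by
    intro s hs
    have : ∃ e' ∈ E, 0 < wordMatrix M (c :: u) s e' := by
      rcases Finset.mem_insert.1 hs with rfl | hs
      · exact step_p'
      · exact step_E s hs
    exact Finset.sum_pos_iff.2 this
  have count : ∀ N, N ≤ ∑ e ∈ E, A N p e := by
    intro N
    induction N with
    | zero => simp
    | succ N ih =>
      have h1 : 1 ≤ A N p p' := (A_pos N p').2 hp'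
      calc N + 1 ≤ A N p p' + ∑ e ∈ E, A N p e := by omega
        _ = ∑ s ∈ insert p' E, A N p s := (Finset.sum_insert p'_notMem).symm
        _ ≤ ∑ s ∈ insert p' E, A N p s * ∑ e' ∈ E, wordMatrix M (c :: u) s e' :=
            Finset.sum_le_sum fun s hs => Nat.le_mul_of_pos_right _ (step_sum s hs)
        _ ≤ ∑ s, A N p s * ∑ e' ∈ E, wordMatrix M (c :: u) s e' :=
            Finset.sum_le_sum_of_subset (Finset.subset_univ _)
        _ = ∑ e' ∈ E, A (N + 1) p e' := by
            simp only [A_succ, Matrix.mul_apply, Finset.mul_sum]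
            exact Finset.sum_comm
  have total : B + 1 ≤ wordMatrix M (x ++ (List.replicate (B + 1) (c :: u)).flatten ++ y) p f := by
    calc B + 1 ≤ ∑ e ∈ E, A (B + 1) p e := count _
      _ ≤ ∑ e ∈ E, A (B + 1) p e * wordMatrix M y e f :=
          Finset.sum_le_sum fun e he =>
            Nat.le_mul_of_pos_right _ (Finset.mem_filter.1 he).2.1
      _ ≤ ∑ e, A (B + 1) p e * wordMatrix M y e f :=
          Finset.sum_le_sum_of_subset (Finset.subset_univ _)
      _ = _ := by rw [wordMatrix_append, Matrix.mul_apply]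
  have := hB (x ++ (List.replicate (B + 1) (c :: u)).flatten ++ y)
  omega

open Classical in
/-- The positions of a word at which a run from `p` to `f` can step from `p'` to `q'`. -/
noncomputable def crossingTimes (M : α → Matrix Q Q ℕ) (τ : List α) (p f p' q' : Q) : Finset ℕ :=
  {t ∈ Finset.range τ.length | 0 < wordMatrix M (τ.take t) p p' ∧
    0 < wordMatrix M ((τ.drop t).take 1) p' q' ∧ 0 < wordMatrix M (τ.drop (t + 1)) q' f}

/-- A transition that cannot be taken twice is taken at boundedly many positions: two positions at
which the same states are reachable and the same states are productive could be pumped. -/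
lemma BoundedRuns.card_crossingTimes_le {p f p' q' : Q} (h : BoundedRuns M p f)
    (hr : ¬ Reaches M q' p') (τ : List α) :
    (crossingTimes M τ p f p' q').card ≤ 4 ^ Fintype.card Q := by
  classical
  let profile : ℕ → Finset Q × Finset Q := fun t =>
    (Finset.univ.filter fun s => 0 < wordMatrix M (τ.take t) p s,
      Finset.univ.filter fun e => 0 < wordMatrix M (τ.drop t) e f)
  have lt_case : ∀ t ∈ crossingTimes M τ p f p' q', ∀ t' ∈ crossingTimes M τ p f p' q',
      profile t = profile t' → ¬ t < t' := by
    intro t ht t' ht' heq hlt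
    simp only [crossingTimes, Finset.mem_filter, Finset.mem_range] at ht ht'
    obtain ⟨ht, h1, h2, h3⟩ := ht
    have hdrop : τ.drop t = τ[t] :: τ.drop (t + 1) := (List.cons_getElem_drop_succ).symm
    obtain ⟨m, rfl⟩ : ∃ m, t' = t + 1 + m := ⟨t' - (t + 1), by omega⟩
    have htake : τ.take (t + 1 + m) = τ.take t ++ τ[t] :: (τ.drop (t + 1)).take m := by
      rw [show t + 1 + m = t + (m + 1) by omega, List.take_add, hdrop, List.take_succ_cons]
    have hd1 : τ.drop (t + 1) = (τ.drop (t + 1)).take m ++ τ.drop (t + 1 + m) := by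
      rw [← List.drop_drop (i := m), List.take_append_drop]
    rw [hdrop] at h2
    simp only [List.take_succ_cons, List.take_zero, wordMatrix_singleton] at h2
    simp only [profile, Prod.mk.injEq, Finset.ext_iff, Finset.mem_filter, Finset.mem_univ,
      true_and] at heq
    refine not_boundedRuns_of_pump (M := M) (p := p) (f := f) (p' := p') (q' := q')
      (x := τ.take t) (u := (τ.drop (t + 1)).take m) (y := τ.drop (t + 1 + m)) (c := τ[t])
      ?_ ?_ h1 h2 ?_ hr h
    · intro s
      rw [← htake]
      exact (heq.1 s).symm
    · intro e
      rw [List.cons_append, ← hd1, ← hdrop]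
      exact heq.2 e
    · rw [← hd1]; exact h3
  have hinj : Set.InjOn profile (crossingTimes M τ p f p' q' : Set ℕ) := by
    intro t ht t' ht' heq
    rcases lt_trichotomy t t' with hlt | rfl | hlt
    · exact absurd hlt (lt_case t ht t' ht' heq)
    · rfl
    · exact absurd hlt (lt_case t' ht' t ht heq.symm)
  calc (crossingTimes M τ p f p' q').card
      ≤ (Finset.univ : Finset (Finset Q × Finset Q)).card :=
        Finset.card_le_card_of_injOn profile (fun _ _ => Finset.mem_coe.2 (Finset.mem_univ _)) hinj
    _ = 4 ^ Fintype.card Q := by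
        rw [Finset.card_univ, Fintype.card_prod, Fintype.card_finset, ← Nat.mul_pow]

/-- A run that starts in `C` and ends outside of `C` steps out of `C` for a first time. The right
hand side counts it there; it may count more, as the prefix of the run up to that step is not
required to stay in `C`. -/
lemma entry_le_sum_exits (C : Finset Q) {f : Q} (hf : f ∉ C) (τ : List α) :
    ∀ p ∈ C, wordMatrix M τ p f ≤ ∑ t ∈ Finset.range τ.length, ∑ p' ∈ C, ∑ q' ∈ Cᶜ,
      wordMatrix M (τ.take t) p p' * wordMatrix M ((τ.drop t).take 1) p' q' *
        wordMatrix M (τ.drop (t + 1)) q' f := by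
  induction τ with
  | nil =>
    intro p hp
    have : p ≠ f := fun h => hf (h ▸ hp)
    simp [this]
  | cons a τ ih =>
    intro p hp
    rw [List.length_cons, Finset.sum_range_succ', wordMatrix_cons, Matrix.mul_apply,
      ← Finset.sum_add_sum_compl C]
    refine Nat.add_le_add ?_ ?_
    · calc ∑ r ∈ C, M a p r * wordMatrix M τ r f
          ≤ ∑ r ∈ C, M a p r * ∑ t ∈ Finset.range τ.length, ∑ p' ∈ C, ∑ q' ∈ Cᶜ,
            wordMatrix M (τ.take t) r p' * wordMatrix M ((τ.drop t).take 1) p' q' *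
              wordMatrix M (τ.drop (t + 1)) q' f :=
            Finset.sum_le_sum fun r hr => Nat.mul_le_mul_left _ (ih r hr)
        _ = ∑ t ∈ Finset.range τ.length, ∑ p' ∈ C, ∑ q' ∈ Cᶜ,
            (∑ r ∈ C, M a p r * wordMatrix M (τ.take t) r p') *
              wordMatrix M ((τ.drop t).take 1) p' q' * wordMatrix M (τ.drop (t + 1)) q' f := by
            simp only [Finset.mul_sum, Finset.sum_mul]
            rw [Finset.sum_comm]
            refine Finset.sum_congr rfl fun t _ => ?_
            rw [Finset.sum_comm]
            refine Finset.sum_congr rfl fun p' _ => ?_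
            rw [Finset.sum_comm]
            refine Finset.sum_congr rfl fun q' _ => ?_
            refine Finset.sum_congr rfl fun r _ => ?_
            ring
        _ ≤ _ := by
            refine Finset.sum_le_sum fun t _ => Finset.sum_le_sum fun p' _ =>
              Finset.sum_le_sum fun q' _ => ?_
            simp only [List.take_succ_cons, List.drop_succ_cons]
            refine Nat.mul_le_mul_right _ (Nat.mul_le_mul_right _ ?_)
            rw [wordMatrix_cons, Matrix.mul_apply]
            exact Finset.sum_le_sum_of_subset (Finset.subset_univ _)
    · refine le_trans ?_ (Finset.single_le_sum (f := fun p' => ∑ q' ∈ Cᶜ,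
        wordMatrix M ((a :: τ).take 0) p p' * wordMatrix M (((a :: τ).drop 0).take 1) p' q' *
          wordMatrix M ((a :: τ).drop (0 + 1)) q' f) (fun _ _ => Nat.zero_le _) hp)
      simp [wordMatrix_singleton]

open Classical in
/-- The explicit bound on the number of runs in the finitely ambiguous case, by induction on the
number of states that can be reached from `p`: a run is unique as long as it stays in the strongly
connected component of `p`, and a step out of the component strictly decreases this number. -/
theorem BoundedRuns.entry_le {K : ℕ} (hK : ∀ a p q, M a p q ≤ K) {f : Q} :
    ∀ (h : ℕ) (p : Q), BoundedRuns M p f → (Finset.univ.filter (Reaches M p)).card ≤ h →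
      ∀ τ : List α, wordMatrix M τ p f ≤
        (1 + Fintype.card Q * (Fintype.card Q * (4 ^ Fintype.card Q * K))) ^ h := by
  set m := Fintype.card Q with hm
  intro h
  induction h with
  | zero =>
    intro p _ hcard
    have : p ∈ Finset.univ.filter (Reaches M p) := by simp [Reaches.refl]
    rw [Nat.le_zero, Finset.card_eq_zero] at hcard
    simp [hcard] at this
  | succ h ih =>
    intro p hb hcard τ
    set G := 1 + m * (m * (4 ^ m * K)) with hG
    have hGpos : 0 < G := by omega
    have hpow : 1 ≤ G ^ h := Nat.pos_of_ne_zero (by positivity)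
    let C : Finset Q := {q | Reaches M p q ∧ Reaches M q p}
    have mem_C : ∀ q, q ∈ C ↔ Reaches M p q ∧ Reaches M q p := by simp [C]
    by_cases hpf : Reaches M p f
    swap
    · have : wordMatrix M τ p f = 0 := by
        by_contra h0
        exact hpf ⟨τ, Nat.pos_of_ne_zero h0⟩
      omega
    have hpp : BoundedRuns M p p := hb.of_reaches (Reaches.refl M p) hpf
    by_cases hf : f ∈ C
    · exact (hpp.entry_le_one ((mem_C f).1 hf).2 τ).trans (Nat.pos_of_ne_zero (by positivity))
    have hterm : ∀ p' ∈ C, ∀ q' ∈ Cᶜ, ∑ t ∈ Finset.range τ.length,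
        wordMatrix M (τ.take t) p p' * wordMatrix M ((τ.drop t).take 1) p' q' *
          wordMatrix M (τ.drop (t + 1)) q' f ≤ 4 ^ m * (K * G ^ h) := by
      intro p' hp' q' hq'
      rw [Finset.mem_compl] at hq'
      rw [mem_C] at hp'
      have hsub : ∑ t ∈ Finset.range τ.length,
          wordMatrix M (τ.take t) p p' * wordMatrix M ((τ.drop t).take 1) p' q' *
            wordMatrix M (τ.drop (t + 1)) q' f
          = ∑ t ∈ crossingTimes M τ p f p' q',
          wordMatrix M (τ.take t) p p' * wordMatrix M ((τ.drop t).take 1) p' q' *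
            wordMatrix M (τ.drop (t + 1)) q' f := by
        refine (Finset.sum_subset (Finset.filter_subset _ _) ?_).symm
        intro t ht hnot
        by_contra hne
        refine hnot (Finset.mem_filter.2 ⟨ht, ?_⟩)
        simp only [Nat.pos_iff_ne_zero]
        simp only [mul_eq_zero, not_or] at hne
        tauto
      rw [hsub]
      rcases (crossingTimes M τ p f p' q').eq_empty_or_nonempty with hempty | ⟨t₀, ht₀⟩
      · rw [hempty]; simp
      obtain ⟨-, h1, h2, h3⟩ := Finset.mem_filter.1 ht₀
      have hpq' : Reaches M p q' := Reaches.trans ⟨_, h1⟩ ⟨_, h2⟩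
      have hq'p : ¬ Reaches M q' p := fun hh => hq' ((mem_C q').2 ⟨hpq', hh⟩)
      have hq'p' : ¬ Reaches M q' p' := fun hh => hq'p (hh.trans hp'.2)
      have hlt : (Finset.univ.filter (Reaches M q')).card
          < (Finset.univ.filter (Reaches M p)).card := by
        refine Finset.card_lt_card ((Finset.ssubset_iff_of_subset ?_).2 ⟨p, ?_, ?_⟩)
        · intro r hr
          simp only [Finset.mem_filter, Finset.mem_univ, true_and] at hr ⊢
          exact hpq'.trans hr
        · simp [Reaches.refl]
        · simpa using hq'p
      have hq'b : BoundedRuns M q' f := hb.of_reaches hpq' (Reaches.refl M f)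
      refine (Finset.sum_le_card_nsmul _ _ (K * G ^ h) ?_).trans ?_
      · intro t ht
        have ht' : t < τ.length := Finset.mem_range.1 (Finset.mem_filter.1 ht).1
        have e1 : wordMatrix M (τ.take t) p p' ≤ 1 := hpp.entry_le_one hp'.2 _
        have e2 : wordMatrix M ((τ.drop t).take 1) p' q' ≤ K := by
          rw [← List.cons_getElem_drop_succ (h := ht'), List.take_succ_cons, List.take_zero,
            wordMatrix_singleton]
          exact hK _ _ _
        have e3 := ih q' hq'b (by omega) (τ.drop (t + 1))
        calc _ ≤ 1 * K * G ^ h := Nat.mul_le_mul (Nat.mul_le_mul e1 e2) e3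
          _ = K * G ^ h := by ring
      · rw [smul_eq_mul]
        exact Nat.mul_le_mul_right _ (hb.card_crossingTimes_le hq'p' τ)
    calc wordMatrix M τ p f ≤ _ :=
          entry_le_sum_exits C hf τ p ((mem_C p).2 ⟨Reaches.refl M p, Reaches.refl M p⟩)
      _ = ∑ p' ∈ C, ∑ q' ∈ Cᶜ, ∑ t ∈ Finset.range τ.length,
          wordMatrix M (τ.take t) p p' * wordMatrix M ((τ.drop t).take 1) p' q' *
            wordMatrix M (τ.drop (t + 1)) q' f := by
          rw [Finset.sum_comm]
          exact Finset.sum_congr rfl fun p' _ => Finset.sum_comm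
      _ ≤ ∑ p' ∈ C, ∑ q' ∈ Cᶜ, 4 ^ m * (K * G ^ h) :=
          Finset.sum_le_sum fun p' hp' => Finset.sum_le_sum fun q' hq' => hterm p' hp' q' hq'
      _ ≤ m * (m * (4 ^ m * (K * G ^ h))) := by
          simp only [Finset.sum_const, smul_eq_mul]
          exact Nat.mul_le_mul (Finset.card_le_univ _)
            (Nat.mul_le_mul_right _ (Finset.card_le_univ _))
      _ ≤ G ^ (h + 1) := by
          rw [pow_succ, hG]
          ring_nf
          omega

end Ambiguity

/-! ### Interchangeable histories -/

section Interchangeable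

variable {Γ Q : Type*} {R : DFA (Γ × Γ) Q}

lemma eval_zip_append {τ τ' : List Γ} (h : τ.length = τ'.length) (u u' : List Γ) :
    R.eval ((τ ++ u).zip (τ' ++ u')) = R.evalFrom (R.eval (τ.zip τ')) (u.zip u') := by
  rw [List.zip_append h, DFA.eval, DFA.evalFrom_of_append]

lemma eval_zip_concat {τ τ' : List Γ} (h : τ.length = τ'.length) (a b : Γ) :
    R.eval ((τ ++ [a]).zip (τ' ++ [b])) = R.step (R.eval (τ.zip τ')) (a, b) := by
  rw [eval_zip_append h]
  simp

lemma recognisedRel_iff {τ τ' : List Γ} (h : τ.length = τ'.length) :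
    recognisedRel R τ τ' ↔ R.eval (τ.zip τ') ∈ R.accept := by
  simp [recognisedRel, h, DFA.mem_accepts]

/-- Equality of states of the minimised automaton, expressed by the recognised relation alone. -/
lemma pairState_eq_iff {τ τ' π π' : List Γ} (h : τ.length = τ'.length)
    (h' : π.length = π'.length) :
    pairState R τ τ' = pairState R π π' ↔ ∀ u u' : List Γ, u.length = u'.length →
      (recognisedRel R (τ ++ u) (τ' ++ u') ↔ recognisedRel R (π ++ u) (π' ++ u')) := by
  have key : ∀ u u' : List Γ, u.length = u'.length →
      ((recognisedRel R (τ ++ u) (τ' ++ u') ↔ recognisedRel R (π ++ u) (π' ++ u')) ↔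
        (u.zip u' ∈ R.acceptsFrom (R.eval (τ.zip τ')) ↔
          u.zip u' ∈ R.acceptsFrom (R.eval (π.zip π')))) := by
    intro u u' hu
    rw [recognisedRel_iff (by simp [h, hu]), recognisedRel_iff (by simp [h', hu]),
      eval_zip_append h, eval_zip_append h', DFA.mem_acceptsFrom, DFA.mem_acceptsFrom]
  have : pairState R τ τ' = pairState R π π' ↔
      R.acceptsFrom (R.eval (τ.zip τ')) = R.acceptsFrom (R.eval (π.zip π')) := Quotient.eq
  rw [this]
  constructor
  · intro heq u u' hu
    rw [key u u' hu, heq]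
  · intro hall
    ext x
    have hx : x = (x.map Prod.fst).zip (x.map Prod.snd) := by
      rw [← List.unzip_fst, ← List.unzip_snd, List.zip_unzip]
    have := (key (x.map Prod.fst) (x.map Prod.snd) (by simp)).1 (hall _ _ (by simp))
    rwa [← hx] at this

lemma pairState_append {τ τ' π π' u u' : List Γ} (h : τ.length = τ'.length)
    (h' : π.length = π'.length) (hu : u.length = u'.length)
    (heq : pairState R τ τ' = pairState R π π') :
    pairState R (τ ++ u) (τ' ++ u') = pairState R (π ++ u) (π' ++ u') := by
  rw [pairState_eq_iff (by simp [h, hu]) (by simp [h', hu])]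
  intro v v' hv
  simp only [List.append_assoc]
  exact (pairState_eq_iff h h').1 heq _ _ (by simp [hu, hv])

lemma recognisedRel_congr {τ τ' π π' : List Γ} (h : τ.length = τ'.length)
    (h' : π.length = π'.length) (heq : pairState R τ τ' = pairState R π π') :
    recognisedRel R τ τ' ↔ recognisedRel R π π' := by
  simpa using (pairState_eq_iff h h').1 heq [] [] rfl

lemma recognisedRel_of_append (hR : IsIndistinguishability (recognisedRel R))
    {τ τ' u u' : List Γ} (h : τ.length = τ'.length)
    (hrel : recognisedRel R (τ ++ u) (τ' ++ u')) : recognisedRel R τ τ' := by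
  have := hR.perfectRecall _ _ hrel τ.length (by simp)
  rw [List.take_left, h, List.take_left] at this
  exact this

/-- Inside an indistinguishability relation, interchangeability is tested by common extensions. -/
lemma interchangeable_iff (hR : IsIndistinguishability (recognisedRel R))
    {τ τ' : List Γ} :
    Interchangeable R τ τ' ↔
      τ.length = τ'.length ∧ ∀ u, recognisedRel R (τ ++ u) (τ' ++ u) := by
  refine and_congr_right fun hlen => ⟨fun h u => ?_, fun h π hπ => ?_⟩
  · have := (pairState_eq_iff hlen rfl).1 (h τ' hlen.symm) u u rfl
    exact this.2 (hR.equivalence.refl _)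
  · rw [pairState_eq_iff hπ.symm (hlen.symm.trans hπ.symm)]
    intro u u' _
    exact ⟨hR.equivalence.trans (hR.equivalence.symm (h u)), hR.equivalence.trans (h u)⟩

lemma Interchangeable.refl (τ : List Γ) : Interchangeable R τ τ := ⟨rfl, fun _ _ => rfl⟩

lemma Interchangeable.symm {τ τ' : List Γ} (h : Interchangeable R τ τ') :
    Interchangeable R τ' τ :=
  ⟨h.1.symm, fun π hπ => (h.2 π (hπ.trans h.1.symm)).symm⟩

lemma Interchangeable.trans {τ τ' τ'' : List Γ} (h : Interchangeable R τ τ')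
    (h' : Interchangeable R τ' τ'') : Interchangeable R τ τ'' :=
  ⟨h.1.trans h'.1, fun π hπ => (h.2 π hπ).trans (h'.2 π (hπ.trans h.1))⟩

lemma Interchangeable.related (hR : IsIndistinguishability (recognisedRel R))
    {τ τ' : List Γ} (h : Interchangeable R τ τ') :
    recognisedRel R τ τ' := by
  simpa using ((interchangeable_iff hR).1 h).2 []

lemma Interchangeable.append (hR : IsIndistinguishability (recognisedRel R))
    {τ τ' : List Γ} (h : Interchangeable R τ τ') (u : List Γ) :
    Interchangeable R (τ ++ u) (τ' ++ u) := by
  rw [interchangeable_iff hR] at h ⊢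
  exact ⟨by simp [h.1], fun v => by simpa using h.2 (u ++ v)⟩

/-- Whether two histories are interchangeable depends only on the state reached on the pair. -/
lemma interchangeable_congr (hR : IsIndistinguishability (recognisedRel R))
    {τ τ' π π' : List Γ} (h : τ.length = τ'.length)
    (h' : π.length = π'.length) (heq : pairState R τ τ' = pairState R π π') :
    Interchangeable R τ τ' ↔ Interchangeable R π π' := by
  rw [interchangeable_iff hR, interchangeable_iff hR]
  simp only [h, h', true_and]
  exact forall_congr' fun u => (pairState_eq_iff h h').1 heq u u rfl

end Interchangeable

/-! ### Lexicographically least members of interchangeability classes -/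

section Lex

variable {Γ : Type*} [LinearOrder Γ]

lemma concat_lt_concat_iff {ρ ρ' : List Γ} (h : ρ.length = ρ'.length) (a b : Γ) :
    ρ ++ [a] < ρ' ++ [b] ↔ ρ < ρ' ∨ ρ = ρ' ∧ a < b := by
  induction ρ generalizing ρ' with
  | nil =>
    obtain rfl : ρ' = [] := List.length_eq_zero_iff.1 h.symm
    simp [List.cons_lt_cons_iff]
  | cons c ρ ih =>
    obtain _ | ⟨c', ρ'⟩ := ρ'
    · simp at h
    · simp only [List.cons_append, List.cons_lt_cons_iff, List.cons.injEq]
      rw [ih (by simpa using h)]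
      tauto

lemma concat_le_concat_iff {ρ ρ' : List Γ} (h : ρ.length = ρ'.length) (a b : Γ) :
    ρ ++ [a] ≤ ρ' ++ [b] ↔ ρ < ρ' ∨ ρ = ρ' ∧ a ≤ b := by
  rw [← not_lt, concat_lt_concat_iff h.symm]
  constructor
  · intro hh
    push Not at hh
    rcases lt_trichotomy ρ ρ' with h1 | h1 | h1
    · exact Or.inl h1
    · exact Or.inr ⟨h1, hh.2 h1.symm⟩
    · exact absurd h1 (not_lt.2 hh.1)
  · rintro (h1 | ⟨rfl, h1⟩)
    · rintro (h2 | ⟨rfl, -⟩)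
      · exact lt_asymm h1 h2
      · exact lt_irrefl _ h1
    · rintro (h2 | ⟨-, h2⟩)
      · exact lt_irrefl _ h2
      · exact not_lt.2 h1 h2

end Lex

section ClassMinima

variable {Γ Q : Type*} [LinearOrder Γ] {R : DFA (Γ × Γ) Q}

/-- The history is the lexicographically least member of its interchangeability class. -/
def IsClassMinimum (R : DFA (Γ × Γ) Q) (ρ : List Γ) : Prop :=
  ∀ ρ', Interchangeable R ρ' ρ → ρ ≤ ρ'

lemma mem_classMinima {τ ρ : List Γ} :
    ρ ∈ classMinima R τ ↔ recognisedRel R τ ρ ∧ IsClassMinimum R ρ := Iff.rfl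

lemma classMinima_finite [Finite Γ] (τ : List Γ) : (classMinima R τ).Finite :=
  (List.finite_length_eq Γ τ.length).subset fun _ h => h.1.1.symm

lemma exists_isClassMinimum [Finite Γ] (τ : List Γ) :
    ∃ ρ, Interchangeable R ρ τ ∧ IsClassMinimum R ρ := by
  have hfin : {ρ : List Γ | Interchangeable R ρ τ}.Finite :=
    (List.finite_length_eq Γ τ.length).subset fun _ h => h.1
  obtain ⟨ρ, hρ, hmin⟩ := Set.exists_min_image _ id hfin ⟨τ, Interchangeable.refl τ⟩
  exact ⟨ρ, hρ, fun ρ' h => hmin ρ' (h.trans hρ)⟩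

lemma IsClassMinimum.eq_of_interchangeable {ρ ρ' : List Γ} (h : IsClassMinimum R ρ)
    (h' : IsClassMinimum R ρ') (hi : Interchangeable R ρ ρ') : ρ = ρ' :=
  le_antisymm (h ρ' hi.symm) (h' ρ hi)

/-- The least members are closed under prefixes, as interchangeability is a right congruence. -/
lemma IsClassMinimum.of_concat (hR : IsIndistinguishability (recognisedRel R)) {ρ : List Γ} {a : Γ}
    (h : IsClassMinimum R (ρ ++ [a])) : IsClassMinimum R ρ := by
  intro ρ' hρ'
  have := h _ (hρ'.append hR [a])
  rw [concat_le_concat_iff hρ'.1.symm] at this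
  rcases this with h | ⟨h, -⟩
  · exact h.le
  · exact h.le

lemma exists_mem_classMinima [Finite Γ] (hR : IsIndistinguishability (recognisedRel R))
    {τ ρ : List Γ} (h : recognisedRel R τ ρ) : ∃ w ∈ classMinima R τ, Interchangeable R w ρ := by
  obtain ⟨w, hw, hmin⟩ := exists_isClassMinimum (R := R) ρ
  exact ⟨w, ⟨hR.equivalence.trans h (hR.equivalence.symm (hw.related hR)), hmin⟩, hw⟩

lemma classMinima_congr (hR : IsIndistinguishability (recognisedRel R)) {τ τ' : List Γ}
    (h : recognisedRel R τ τ') : classMinima R τ = classMinima R τ' := by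
  ext ρ
  rw [mem_classMinima, mem_classMinima]
  exact and_congr_left fun _ =>
    ⟨hR.equivalence.trans (hR.equivalence.symm h), hR.equivalence.trans h⟩

/-! ### The indexed matrix of a history -/

lemma IsIndexedMatrixOf.unique {τ : List Γ} {X Y : IndexedMatrix (MinState R)}
    (hX : IsIndexedMatrixOf R τ X) (hY : IsIndexedMatrixOf R τ Y) : X = Y := by
  obtain ⟨w, hw, hwr, hwm, hwi⟩ := hX
  obtain ⟨v, hv, hvr, hvm, hvi⟩ := hY
  obtain ⟨d, A, i⟩ := X
  obtain ⟨e, B, j⟩ := Y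
  dsimp only at w v hw hwr hwm hwi hv hvr hvm hvi
  have hd : d = e := by
    have h1 := Set.ncard_range_of_injective hw.injective
    have h2 := Set.ncard_range_of_injective hv.injective
    rw [hwr, ← hvr, h2] at h1
    simpa using h1.symm
  subst hd
  obtain rfl : w = v := (hw.range_inj hv).1 (hwr.trans hvr.symm)
  obtain rfl : A = B := by
    ext a b
    rw [hwm, hvm]
  have hmem : ∀ a, IsClassMinimum R (w a) := fun a =>
    (hwr ▸ Set.mem_range_self a : w a ∈ classMinima R τ).2
  obtain rfl : i = j :=
    hw.injective ((hmem i).eq_of_interchangeable (hmem j) (hwi.trans hvi.symm))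
  rfl

lemma exists_isIndexedMatrixOf [Finite Γ] (hR : IsIndistinguishability (recognisedRel R))
    (τ : List Γ) : ∃ X, IsIndexedMatrixOf R τ X := by
  let s := (classMinima_finite (R := R) τ).toFinset
  let w : Fin s.card → List Γ := s.orderEmbOfFin rfl
  have hw : Set.range w = classMinima R τ := by
    simp only [w, Finset.range_orderEmbOfFin]
    simp [s]
  obtain ⟨ρ, hρ, hi⟩ := exists_mem_classMinima hR (hR.equivalence.refl τ)
  obtain ⟨i, rfl⟩ : ρ ∈ Set.range w := hw ▸ hρ
  exact ⟨⟨s.card, fun i j => pairState R (w i) (w j), i⟩, w, (s.orderEmbOfFin rfl).strictMono, hw,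
    fun _ _ => rfl, hi⟩

lemma IsIndexedMatrixOf.dim_eq {τ : List Γ} {X : IndexedMatrix (MinState R)}
    (hX : IsIndexedMatrixOf R τ X) : X.dim = (classMinima R τ).ncard := by
  obtain ⟨w, hw, hwr, -, -⟩ := hX
  rw [← hwr, Set.ncard_range_of_injective hw.injective]
  simp

/-- The least members of the classes contained in the information set of `τ ++ [a]` are one-letter
extensions of those contained in the information set of `τ`. -/
lemma classMinima_concat [Finite Γ] (hR : IsIndistinguishability (recognisedRel R)) {τ : List Γ}
    {ι : Type*} {w : ι → List Γ} (hw : Set.range w = classMinima R τ) {i₀ : ι}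
    (hi₀ : Interchangeable R (w i₀) τ) (a : Γ) :
    classMinima R (τ ++ [a]) =
      {ρ | ∃ x : ι × Γ, w x.1 ++ [x.2] = ρ ∧
        recognisedRel R (w i₀ ++ [a]) (w x.1 ++ [x.2]) ∧
        ∀ y : ι × Γ, Interchangeable R (w y.1 ++ [y.2]) (w x.1 ++ [x.2]) →
          w x.1 ++ [x.2] ≤ w y.1 ++ [y.2]} := by
  have hmem : ∀ i, w i ∈ classMinima R τ := fun i => hw ▸ Set.mem_range_self i
  have hrel := (hi₀.append hR [a]).related hR
  ext ρ
  simp only [Set.mem_ofPred_eq]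
  constructor
  · rintro ⟨h1, h2⟩
    rcases List.eq_nil_or_concat ρ with rfl | ⟨v, b, rfl⟩
    · simpa using h1.1
    rw [List.concat_eq_append] at h1 h2 ⊢
    have hlen : τ.length = v.length := by simpa using h1.1
    have hv : v ∈ classMinima R τ :=
      ⟨recognisedRel_of_append hR hlen h1, IsClassMinimum.of_concat hR h2⟩
    obtain ⟨i, rfl⟩ : v ∈ Set.range w := hw ▸ hv
    exact ⟨(i, b), rfl, hR.equivalence.trans hrel h1, fun y hy => h2 _ hy⟩
  · rintro ⟨⟨i, b⟩, rfl, h1, h2⟩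
    refine ⟨hR.equivalence.trans (hR.equivalence.symm hrel) h1, fun ρ' hρ' => ?_⟩
    rcases List.eq_nil_or_concat ρ' with rfl | ⟨v, c, rfl⟩
    · simpa using hρ'.1
    rw [List.concat_eq_append] at hρ' ⊢
    have hlen : v.length = (w i).length := by simpa using hρ'.1
    have hv : recognisedRel R v (w i) := recognisedRel_of_append hR hlen (hρ'.related hR)
    obtain ⟨u, hu, hui⟩ := exists_mem_classMinima hR
      (hR.equivalence.trans (hmem i).1 (hR.equivalence.symm hv))
    obtain ⟨j, rfl⟩ : u ∈ Set.range w := hw ▸ hu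
    refine (h2 (j, c) ((hui.append hR [c]).trans hρ')).trans ?_
    rw [concat_le_concat_iff hui.1]
    rcases (hu.2 v hui.symm).lt_or_eq with h | h
    · exact Or.inl h
    · exact Or.inr ⟨h, le_rfl⟩

/-- The indexed matrix of `τ ++ [a]` is determined by that of `τ` and the letter `a`. -/
theorem IsIndexedMatrixOf.concat [Finite Γ] (hR : IsIndistinguishability (recognisedRel R))
    {τ τ' : List Γ} {X Y : IndexedMatrix (MinState R)} (hX : IsIndexedMatrixOf R τ X)
    (hX' : IsIndexedMatrixOf R τ' X) {a : Γ} (hY : IsIndexedMatrixOf R (τ ++ [a]) Y) :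
    IsIndexedMatrixOf R (τ' ++ [a]) Y := by
  obtain ⟨w, hw, hwr, hwm, hwi⟩ := hX
  obtain ⟨w', hw', hwr', hwm', hwi'⟩ := hX'
  obtain ⟨v, hv, hvr, hvm, hvi⟩ := hY
  let g : Fin X.dim × Γ → List Γ := fun x => w x.1 ++ [x.2]
  let g' : Fin X.dim × Γ → List Γ := fun x => w' x.1 ++ [x.2]
  have len : ∀ i, (w i).length = τ.length := fun i =>
    (hwr ▸ Set.mem_range_self i : w i ∈ classMinima R τ).1.1.symm
  have len' : ∀ i, (w' i).length = τ'.length := fun i =>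
    (hwr' ▸ Set.mem_range_self i : w' i ∈ classMinima R τ').1.1.symm
  have glen : ∀ x y, (g x).length = (g y).length := fun x y => by simp [g, len]
  have glen' : ∀ x y, (g' x).length = (g' y).length := fun x y => by simp [g', len']
  have hpair : ∀ x y, pairState R (g x) (g y) = pairState R (g' x) (g' y) := fun x y =>
    pairState_append (by simp [len]) (by simp [len']) rfl ((hwm _ _).symm.trans (hwm' _ _))
  have hle : ∀ x y, g x ≤ g y ↔ g' x ≤ g' y := by
    intro x y
    simp only [g, g']
    rw [concat_le_concat_iff (by simp [len]), concat_le_concat_iff (by simp [len']),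
      hw.lt_iff_lt, hw'.lt_iff_lt, hw.injective.eq_iff, hw'.injective.eq_iff]
  have hlt : ∀ x y, g x < g y ↔ g' x < g' y := fun x y => by
    rw [← not_le, ← not_le, hle]
  have hrel : ∀ x y, recognisedRel R (g x) (g y) ↔ recognisedRel R (g' x) (g' y) := fun x y =>
    recognisedRel_congr (glen x y) (glen' x y) (hpair x y)
  have hint : ∀ x y, Interchangeable R (g x) (g y) ↔ Interchangeable R (g' x) (g' y) := fun x y =>
    interchangeable_congr hR (glen x y) (glen' x y) (hpair x y)
  have hmin := classMinima_concat hR hwr hwi a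
  have hmin' := classMinima_concat hR hwr' hwi' a
  have hv' : ∀ i, ∃ x, g x = v i ∧ recognisedRel R (g (X.index, a)) (g x) ∧
      ∀ y, Interchangeable R (g y) (g x) → g x ≤ g y := by
    intro i
    have : v i ∈ classMinima R (τ ++ [a]) := hvr ▸ Set.mem_range_self i
    rw [hmin] at this
    exact this
  choose φ hφ hφ1 hφ2 using hv'
  refine ⟨fun i => g' (φ i), fun i j hij => ?_, ?_, fun i j => ?_, ?_⟩
  · rw [← hlt, hφ, hφ]; exact hv hij
  · rw [hmin']
    ext ρ
    constructor
    · rintro ⟨i, rfl⟩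
      exact ⟨φ i, rfl, (hrel _ _).1 (hφ1 i), fun y hy => (hle _ _).1 (hφ2 i y ((hint _ _).2 hy))⟩
    · rintro ⟨x, rfl, h1, h2⟩
      have hx : g x ∈ classMinima R (τ ++ [a]) := by
        rw [hmin]
        exact ⟨x, rfl, (hrel (X.index, a) x).2 h1, fun y hy => (hle _ _).2 (h2 y ((hint _ _).1 hy))⟩
      rw [← hvr] at hx
      obtain ⟨i, hi⟩ := hx
      refine ⟨i, ?_⟩
      have heq : g (φ i) = g x := (hφ i).trans hi
      exact le_antisymm ((hle _ _).1 heq.le) ((hle _ _).1 heq.ge)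
  · rw [hvm, ← hφ, ← hφ, hpair]
  · have h1 : Interchangeable R (g (φ Y.index)) (g (X.index, a)) := by
      rw [hφ]
      exact hvi.trans (hwi.append hR [a]).symm
    exact ((hint _ _).1 h1).trans (hwi'.append hR [a])

end ClassMinima

/-! ### Counting the second components of accepted pairs -/

section Counting

lemma finite_secondTape {Γ : Type*} [Finite Γ] (τ : List Γ) (P : List Γ → Prop) :
    {v : List Γ | v.length = τ.length ∧ P v}.Finite :=
  (List.finite_length_eq Γ τ.length).subset fun _ h => h.1

variable {Γ Q : Type*} [Fintype Γ] [Fintype Q] [DecidableEq Q]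

/-- The entry `(p, q)` of the matrix of `a` counts the letters `c` for which the transition from
`p` on `(a, c)` leads to `q`. -/
def secondTapeMatrix (A : DFA (Γ × Γ) Q) (a : Γ) : Matrix Q Q ℕ :=
  fun p q => (Finset.univ.filter fun c => A.step p (a, c) = q).card

lemma wordMatrix_secondTapeMatrix (A : DFA (Γ × Γ) Q) (τ : List Γ) (p q : Q) :
    wordMatrix (secondTapeMatrix A) τ p q =
      Nat.card {v : List Γ // v.length = τ.length ∧ A.evalFrom p (τ.zip v) = q} := by
  induction τ generalizing p with
  | nil =>
    rw [wordMatrix_nil, Matrix.one_apply]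
    split_ifs with h
    · subst h
      symm
      rw [Nat.card_eq_one_iff_unique]
      refine ⟨⟨fun ⟨x, hx⟩ ⟨y, hy⟩ => ?_⟩, ⟨⟨[], by simp⟩⟩⟩
      simp only [List.length_nil, List.length_eq_zero_iff] at hx hy
      simp [hx.1, hy.1]
    · symm
      have : IsEmpty {v : List Γ // v.length = ([] : List Γ).length ∧
          A.evalFrom p (([] : List Γ).zip v) = q} := ⟨fun ⟨v, hv⟩ => h (by simpa using hv.2)⟩
      exact Nat.card_of_isEmpty
  | cons a τ ih =>
    let e : {v : List Γ // v.length = (a :: τ).length ∧ A.evalFrom p ((a :: τ).zip v) = q} ≃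
        Σ c : Γ, {v : List Γ // v.length = τ.length ∧
          A.evalFrom (A.step p (a, c)) (τ.zip v) = q} :=
      { toFun := fun v => match v with
          | ⟨c :: v, hv⟩ => ⟨c, v, by simpa using hv.1, by simpa using hv.2⟩
        invFun := fun x => ⟨x.1 :: x.2.1, by simpa using x.2.2.1, by simpa using x.2.2.2⟩
        left_inv := fun v => match v with
          | ⟨c :: v, hv⟩ => rfl
        right_inv := fun x => rfl }
    have hfin : ∀ c, Finite {v : List Γ // v.length = τ.length ∧
        A.evalFrom (A.step p (a, c)) (τ.zip v) = q} := fun c =>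
      (finite_secondTape τ fun v => A.evalFrom (A.step p (a, c)) (τ.zip v) = q).to_subtype
    rw [Nat.card_congr e, Nat.card_sigma, wordMatrix_cons, Matrix.mul_apply]
    simp only [ih, secondTapeMatrix]
    rw [← Finset.sum_fiberwise (s := Finset.univ) (g := fun c => A.step p (a, c))]
    refine Finset.sum_congr rfl fun r _ => ?_
    rw [Finset.sum_congr rfl (g := fun _ => Nat.card {v : List Γ // v.length = τ.length ∧
        A.evalFrom r (τ.zip v) = q})]
    · simp
    · intro c hc
      rw [(Finset.mem_filter.1 hc).2]

/-- The words of the same length as `τ` that an automaton accepts on the second tape when `τ` is on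
the first one. -/
def secondTape (A : DFA (Γ × Γ) Q) (τ : List Γ) : Set (List Γ) :=
  {v | v.length = τ.length ∧ τ.zip v ∈ A.accepts}

lemma card_le_ncard_secondTape (A : DFA (Γ × Γ) Q) (τ : List Γ) {f : Q} (hf : f ∈ A.accept) :
    wordMatrix (secondTapeMatrix A) τ A.start f ≤ (secondTape A τ).ncard := by
  rw [wordMatrix_secondTapeMatrix]
  exact Set.ncard_le_ncard
    (s := {v : List Γ | v.length = τ.length ∧ A.evalFrom A.start (τ.zip v) = f})
    (fun v hv => ⟨hv.1, by rw [DFA.mem_accepts, DFA.eval, hv.2]; exact hf⟩)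
    (finite_secondTape τ _)

/-- A two-tape automaton that admits boundedly many words on the second tape admits at most
exponentially many of them, by the bound for finitely ambiguous products. -/
theorem ncard_secondTape_le (A : DFA (Γ × Γ) Q) {B : ℕ}
    (hB : ∀ τ, (secondTape A τ).ncard ≤ B) (τ : List Γ) :
    (secondTape A τ).ncard ≤ Fintype.card Q * (1 + Fintype.card Q * (Fintype.card Q *
      (4 ^ Fintype.card Q * Fintype.card Γ))) ^ Fintype.card Q := by
  classical
  have hsub : secondTape A τ ⊆ ⋃ f ∈ (Finset.univ.filter (· ∈ A.accept) : Finset Q),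
      {v : List Γ | v.length = τ.length ∧ A.evalFrom A.start (τ.zip v) = f} := by
    rintro v ⟨h1, h2⟩
    simp only [Set.mem_iUnion]
    exact ⟨A.eval (τ.zip v), Finset.mem_filter.2 ⟨Finset.mem_univ _, h2⟩, h1, rfl⟩
  have hcard := Set.ncard_le_ncard hsub
    (Set.Finite.biUnion (Finset.finite_toSet _) fun f _ => finite_secondTape τ _)
  have hK : ∀ a p q, secondTapeMatrix A a p q ≤ Fintype.card Γ :=
    fun a p q => Finset.card_le_univ _
  refine hcard.trans ((Finset.set_ncard_biUnion_le _ _).trans ?_)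
  refine (Finset.sum_le_card_nsmul _ _ _ fun f hf => ?_).trans
    (Nat.mul_le_mul_right _ (Finset.card_le_univ _))
  have hf' := (Finset.mem_filter.1 hf).2
  have hb : BoundedRuns (secondTapeMatrix A) A.start f :=
    ⟨B, fun τ => (card_le_ncard_secondTape A τ hf').trans (hB τ)⟩
  have := hb.entry_le (K := Fintype.card Γ) hK
    (Fintype.card Q) A.start (Finset.card_le_univ _) τ
  rwa [wordMatrix_secondTapeMatrix] at this

end Counting

/-! ### Recognising the least members of the interchangeability classes -/

section MinimaAutomaton

variable {Γ Q : Type*} [LinearOrder Γ]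

/-- The two-tape automaton that accepts the pairs of `τ` and an element of `classMinima R τ`. On
`(τ, v)` it computes the states of `R` on `(τ, v)`, on `(v, v)`, and on all pairs `(v', v)` with
`v'` lexicographically less than `v`. -/
def minimaAutomaton (R : DFA (Γ × Γ) Q) : DFA (Γ × Γ) (Q × Q × Set Q) where
  start := (R.start, R.start, ∅)
  step s x := (R.step s.1 x, R.step s.2.1 (x.2, x.2),
    {r | (∃ q ∈ s.2.2, ∃ c, R.step q (c, x.2) = r) ∨ ∃ c < x.2, R.step s.2.1 (c, x.2) = r})
  accept := {s | s.1 ∈ R.accept ∧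
    ∀ r ∈ s.2.2, ¬ ∀ u : List Γ, R.evalFrom r (u.zip u) ∈ R.accept}

lemma eval_minimaAutomaton (R : DFA (Γ × Γ) Q) (τ v : List Γ) (h : v.length = τ.length) :
    (minimaAutomaton R).eval (τ.zip v) = (R.eval (τ.zip v), R.eval (v.zip v),
      {r | ∃ v' : List Γ, v'.length = v.length ∧ v' < v ∧ R.eval (v'.zip v) = r}) := by
  induction τ using List.reverseRecOn generalizing v with
  | nil =>
    obtain rfl : v = [] := List.length_eq_zero_iff.1 h
    simp [minimaAutomaton, DFA.eval]
  | append_singleton τ a ih =>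
    rcases List.eq_nil_or_concat v with rfl | ⟨v, c, rfl⟩
    · simp at h
    rw [List.concat_eq_append] at h ⊢
    have hlen : v.length = τ.length := by simpa using h
    rw [eval_zip_concat hlen.symm, eval_zip_concat hlen.symm, eval_zip_concat rfl, ih v hlen]
    simp only [minimaAutomaton, Prod.mk.injEq, true_and]
    ext r
    simp only [Set.mem_ofPred_eq]
    constructor
    · rintro (⟨q, ⟨v', h1, h2, rfl⟩, c', rfl⟩ | ⟨c', hc', rfl⟩)
      · exact ⟨v' ++ [c'], by simp [h1], (concat_lt_concat_iff h1 _ _).2 (Or.inl h2),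
          eval_zip_concat h1 _ _⟩
      · exact ⟨v ++ [c'], by simp, (concat_lt_concat_iff rfl _ _).2 (Or.inr ⟨rfl, hc'⟩),
          eval_zip_concat rfl _ _⟩
    · rintro ⟨v', h1, h2, rfl⟩
      rcases List.eq_nil_or_concat v' with rfl | ⟨v', c', rfl⟩
      · simp at h1
      rw [List.concat_eq_append] at h1 h2 ⊢
      have h1' : v'.length = v.length := by simpa using h1
      rw [eval_zip_concat h1']
      rcases (concat_lt_concat_iff h1' _ _).1 h2 with hlt | ⟨rfl, hlt⟩
      · exact Or.inl ⟨_, ⟨v', h1', hlt, rfl⟩, c', rfl⟩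
      · exact Or.inr ⟨c', hlt, rfl⟩

lemma secondTape_minimaAutomaton [Fintype Γ] [Fintype Q] {R : DFA (Γ × Γ) Q}
    (hR : IsIndistinguishability (recognisedRel R)) (τ : List Γ) :
    secondTape (minimaAutomaton R) τ = classMinima R τ := by
  ext v
  have key : ∀ v' : List Γ, v'.length = v.length →
      ((∀ u : List Γ, R.evalFrom (R.eval (v'.zip v)) (u.zip u) ∈ R.accept) ↔
        Interchangeable R v' v) := by
    intro v' hv'
    rw [interchangeable_iff hR]
    simp only [hv', true_and]
    refine forall_congr' fun u => ?_
    rw [recognisedRel_iff (by simp [hv']), eval_zip_append hv']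
  rw [mem_classMinima, secondTape, Set.mem_ofPred_eq, DFA.mem_accepts]
  constructor
  · rintro ⟨hlen, hacc⟩
    rw [eval_minimaAutomaton R τ v hlen] at hacc
    refine ⟨(recognisedRel_iff hlen.symm).2 hacc.1, fun v' hv' => ?_⟩
    by_contra hlt
    exact hacc.2 _ ⟨v', hv'.1, not_le.1 hlt, rfl⟩ ((key v' hv'.1).2 hv')
  · rintro ⟨hrel, hmin⟩
    have hlen : v.length = τ.length := hrel.1.symm
    refine ⟨hlen, ?_⟩
    rw [eval_minimaAutomaton R τ v hlen]
    refine ⟨(recognisedRel_iff hlen.symm).1 hrel, ?_⟩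
    rintro r ⟨v', h1, h2, rfl⟩ hall
    exact not_le.2 h2 (hmin v' ((key v' h1).1 hall))

end MinimaAutomaton

/-! ### Bounded branching bounds the number of interchangeability classes -/

section Branching

variable {Γ Q : Type*}

/-- Every state that can be reached is reached by a word that is shorter than the number of
states. -/
lemma exists_short_word {α σ : Type*} [Fintype σ] (A : DFA α σ) (s : σ) (x : List α) :
    ∃ y : List α, y.length < Fintype.card σ ∧ A.evalFrom s y = A.evalFrom s x := by
  induction hn : x.length using Nat.strong_induction_on generalizing x with
  | _ n ih =>
    by_cases hlt : x.length < Fintype.card σ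
    · exact ⟨x, hlt, rfl⟩
    obtain ⟨q, a, b, c, rfl, -, hb, ha, hb', hc⟩ := A.evalFrom_split (not_lt.1 hlt) rfl
    obtain ⟨y, hy, hy'⟩ := ih (a ++ c).length (by
      have := List.length_pos_iff.2 hb
      simp only [List.length_append] at hn ⊢
      omega) (a ++ c) rfl
    refine ⟨y, hy, hy'.trans ?_⟩
    rw [DFA.evalFrom_of_append, ha, hc]

lemma eval_zip_self (R : DFA (Γ × Γ) Q) (q : Q) (u : List Γ) :
    R.evalFrom q (u.zip u) = (R.comap fun a : Γ => (a, a)).evalFrom q u := by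
  rw [DFA.evalFrom_comap]
  congr 1
  induction u with
  | nil => rfl
  | cons a u ih => simp [ih]

/-- Histories of the same length that are not interchangeable are separated by a short common
extension. -/
lemma exists_short_separator [Fintype Q] {R : DFA (Γ × Γ) Q}
    (hR : IsIndistinguishability (recognisedRel R)) {v v' : List Γ} (hlen : v.length = v'.length)
    (h : ¬ Interchangeable R v v') :
    ∃ u : List Γ, u.length < Fintype.card Q ∧ ¬ recognisedRel R (v ++ u) (v' ++ u) := by
  rw [interchangeable_iff hR] at h
  push Not at h
  obtain ⟨u, hu⟩ := h hlen
  obtain ⟨y, hy, hyu⟩ := exists_short_word (R.comap fun a : Γ => (a, a)) (R.eval (v.zip v')) u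
  refine ⟨y, hy, ?_⟩
  rw [recognisedRel_iff (by simp [hlen]), eval_zip_append hlen, eval_zip_self] at hu ⊢
  rwa [hyu]

/-- The information sets `j` levels below `U`. -/
def descendants (s : Setoid (List Γ)) (j : ℕ) (U : Quotient s) : Set (Quotient s) :=
  {U' | ∃ τ u : List Γ, Quotient.mk s τ = U ∧ u.length = j ∧ Quotient.mk s (τ ++ u) = U'}

lemma BoundedBranching.descendants {s : Setoid (List Γ)} (h : BoundedBranching s) (j : ℕ) :
    ∃ B : ℕ, ∀ U, (descendants s j U).Finite ∧ (descendants s j U).ncard ≤ B := by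
  obtain ⟨b, hb⟩ := h
  induction j with
  | zero =>
    refine ⟨1, fun U => ?_⟩
    have : InfoAutomata.descendants s 0 U ⊆ {U} := by
      rintro U' ⟨τ, u, rfl, hu, rfl⟩
      simp [List.length_eq_zero_iff.1 hu]
    exact ⟨(Set.finite_singleton U).subset this,
      (Set.ncard_le_ncard this).trans (Set.ncard_singleton U).le⟩
  | succ j ih =>
    obtain ⟨B, hB⟩ := ih
    refine ⟨B * b, fun U => ?_⟩
    have hsub : InfoAutomata.descendants s (j + 1) U ⊆
        ⋃ V ∈ (hB U).1.toFinset, treeSuccessors s V := by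
      rintro U' ⟨τ, u, rfl, hu, rfl⟩
      rcases List.eq_nil_or_concat u with rfl | ⟨u, c, rfl⟩
      · simp at hu
      rw [List.concat_eq_append] at hu ⊢
      simp only [Set.mem_iUnion]
      refine ⟨Quotient.mk s (τ ++ u), ?_, τ ++ u, c, rfl, by simp⟩
      rw [Set.Finite.mem_toFinset]
      exact ⟨τ, u, rfl, by simpa using hu, rfl⟩
    have hsucc : ∀ V, (treeSuccessors s V).Finite := fun V =>
      Set.finite_of_encard_le_coe (hb V)
    have hfin : (⋃ V ∈ (hB U).1.toFinset, treeSuccessors s V).Finite :=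
      Set.Finite.biUnion (Finset.finite_toSet _) fun V _ => hsucc V
    refine ⟨hfin.subset hsub, (Set.ncard_le_ncard hsub hfin).trans ?_⟩
    refine (Finset.set_ncard_biUnion_le _ _).trans ?_
    refine (Finset.sum_le_card_nsmul _ _ b fun V _ => ?_).trans ?_
    · have := hb V
      rw [← (hsucc V).cast_ncard_eq] at this
      exact_mod_cast this
    · rw [smul_eq_mul, ← Set.ncard_eq_toFinset_card _ (hB U).1]
      exact Nat.mul_le_mul_right _ (hB U).2

/-- A history is determined up to interchangeability by its information set and by the information
sets of its short extensions, of which there are boundedly many. -/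
theorem exists_ncard_classMinima_le [LinearOrder Γ] [Fintype Γ] [Fintype Q] {R : DFA (Γ × Γ) Q}
    (hR : IsIndistinguishability (recognisedRel R)) (hb : BoundedBranching hR.setoid) :
    ∃ B : ℕ, ∀ τ, (classMinima R τ).ncard ≤ B := by
  classical
  choose B hB using hb.descendants
  let W := {u : List Γ // u.length < Fintype.card Q}
  have hW : Finite W := (List.finite_length_lt Γ (Fintype.card Q)).to_subtype
  refine ⟨Nat.card ((u : W) → Fin (B u.1.length)), fun τ => ?_⟩
  have hemb : ∀ j, ∃ e : InfoAutomata.descendants hR.setoid j (Quotient.mk _ τ) → Fin (B j),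
      Function.Injective e := by
    intro j
    have := (hB j (Quotient.mk _ τ)).1.fintype
    have hle : Fintype.card (InfoAutomata.descendants hR.setoid j (Quotient.mk _ τ))
        ≤ Fintype.card (Fin (B j)) := by
      rw [Fintype.card_fin, ← Nat.card_eq_fintype_card]
      exact (hB j (Quotient.mk _ τ)).2
    obtain ⟨e⟩ := Function.Embedding.nonempty_of_card_le hle
    exact ⟨e, e.injective⟩
  choose e he using hemb
  let Φ : classMinima R τ → ((u : W) → Fin (B u.1.length)) := fun v u =>
    e u.1.length ⟨Quotient.mk _ (v.1 ++ u.1), v.1, u.1,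
      Quotient.sound (hR.equivalence.symm v.2.1), rfl, rfl⟩
  refine Nat.card_le_card_of_injective Φ fun v v' heq => ?_
  refine Subtype.ext 
    ((mem_classMinima.1 v.2).2.eq_of_interchangeable (mem_classMinima.1 v'.2).2 ?_)
  by_contra hne
  obtain ⟨u, hu, hnot⟩ := exists_short_separator hR (v.2.1.1.symm.trans v'.2.1.1) hne
  have h1 := congrFun heq ⟨u, hu⟩
  have h2 := he _ h1
  exact hnot (Quotient.exact (congrArg Subtype.val h2))

/-- Under bounded branching, an information set consists of at most doubly exponentially many
interchangeability classes. -/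
theorem ncard_classMinima_le [LinearOrder Γ] [Fintype Γ] [Fintype Q] {R : DFA (Γ × Γ) Q}
    (hR : IsIndistinguishability (recognisedRel R)) (hb : BoundedBranching hR.setoid)
    {m : ℕ} (hm : Fintype.card Q * (Fintype.card Q * 2 ^ Fintype.card Q) = m) (τ : List Γ) :
    (classMinima R τ).ncard ≤ m * (1 + m * (m * (4 ^ m * Fintype.card Γ))) ^ m := by
  classical
  obtain ⟨B, hB⟩ := exists_ncard_classMinima_le hR hb
  have hcard : Fintype.card (Q × Q × Set Q) = m := by
    simp [Fintype.card_prod, hm]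
  have := ncard_secondTape_le (minimaAutomaton R) (B := B)
    (fun τ => by rw [secondTape_minimaAutomaton hR]; exact hB τ) τ
  rwa [hcard, secondTape_minimaAutomaton hR] at this

end Branching

/-! ### The number of indexed matrices -/

/-- The arithmetic behind the triply exponential bound: there are at most
`(D + 1) * (n ^ (D * D) * D)` indexed matrices of dimension at most `D` over `n` states. -/
lemma card_bound_le {n k m D : ℕ} (hn : 1 ≤ n) (hk : 1 ≤ k) (hm : n * (n * 2 ^ n) = m)
    (hD : D = m * (1 + m * (m * (4 ^ m * k))) ^ m) :
    (D + 1) * (n ^ (D * D) * D) * k ≤ 2 ^ (2 ^ (2 ^ (11 * (n * (k * k)) ^ 2))) := by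
  obtain ⟨e, he⟩ : ∃ e, e = n * (k * k) := ⟨_, rfl⟩
  have hkk : k ≤ k * k := Nat.le_mul_of_pos_left _ hk
  have hne : n ≤ e := by rw [he]; exact Nat.le_mul_of_pos_right _ (by positivity)
  have hke : k ≤ e := by rw [he]; exact hkk.trans (Nat.le_mul_of_pos_left _ hn)
  have he1 : 1 ≤ e := hn.trans hne
  have hlt : ∀ x : ℕ, x ≤ 2 ^ x := fun x => x.lt_two_pow_self.le
  have hm1 : 1 ≤ m := by rw [← hm]; exact Nat.pos_of_ne_zero (by positivity)
  -- `M` dominates both `m` and `e`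
  obtain ⟨M, hM⟩ : ∃ M, M = 2 ^ (3 * e) := ⟨_, rfl⟩
  have hM8 : 8 ≤ M := by
    rw [hM]; calc 8 = 2 ^ 3 := rfl
      _ ≤ _ := Nat.pow_le_pow_right (by norm_num) (by omega)
  have heM : e ≤ M := by
    rw [hM]; exact (hlt e).trans (Nat.pow_le_pow_right (by norm_num) (by omega))
  have hmM : m ≤ M := by
    rw [← hm, hM]
    calc n * (n * 2 ^ n) ≤ 2 ^ e * (2 ^ e * 2 ^ e) :=
          Nat.mul_le_mul (hne.trans (hlt e)) (Nat.mul_le_mul (hne.trans (hlt e))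
            (Nat.pow_le_pow_right (by norm_num) hne))
      _ = 2 ^ (3 * e) := by rw [← pow_add, ← pow_add]; congr 1; ring
  have hbase : 1 + m * (m * (4 ^ m * k)) ≤ 2 ^ (5 * M + 1) := by
    have h1 : m * (m * (4 ^ m * k)) ≤ 2 ^ (5 * M) := by
      calc m * (m * (4 ^ m * k)) ≤ 2 ^ M * (2 ^ M * (2 ^ (2 * M) * 2 ^ M)) := by
            refine Nat.mul_le_mul (hmM.trans (hlt M)) (Nat.mul_le_mul (hmM.trans (hlt M))
              (Nat.mul_le_mul ?_ ((hke.trans heM).trans (hlt M))))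
            rw [pow_mul]
            exact Nat.pow_le_pow_right (by norm_num) hmM
        _ = 2 ^ (5 * M) := by rw [← pow_add, ← pow_add, ← pow_add]; congr 1; ring
    have h2 : 1 ≤ 2 ^ (5 * M) := Nat.one_le_two_pow
    rw [pow_succ]
    omega
  obtain ⟨E, hE⟩ : ∃ E, E = 2 ^ (2 ^ (9 * e)) := ⟨_, rfl⟩
  have hDE : D ≤ E := by
    have h1 : M + (5 * M + 1) * M ≤ 2 ^ (9 * e) := by
      have : (2 : ℕ) ^ (9 * e) = M ^ 3 := by rw [hM, ← pow_mul]; congr 1; ring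
      rw [this]
      nlinarith [Nat.mul_le_mul hM8 hM8, Nat.mul_le_mul_right (M * M) hM8]
    calc D ≤ 2 ^ M * (2 ^ (5 * M + 1)) ^ M := by
          rw [hD]
          refine Nat.mul_le_mul (hmM.trans (hlt M)) ((Nat.pow_le_pow_left hbase m).trans ?_)
          exact Nat.pow_le_pow_right (by positivity) hmM
      _ = 2 ^ (M + (5 * M + 1) * M) := by rw [← pow_mul, ← pow_add]
      _ ≤ E := by rw [hE]; exact Nat.pow_le_pow_right (by norm_num) h1
  have heE : e ≤ E := by
    rw [hE]
    exact (hlt e).trans (Nat.pow_le_pow_right (by norm_num)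
      ((hlt e).trans (Nat.pow_le_pow_right (by norm_num) (by omega))))
  have hE4 : 4 ≤ E := by
    rw [hE]
    calc 4 = 2 ^ 2 := rfl
      _ ≤ _ := Nat.pow_le_pow_right (by norm_num) ?_
    calc 2 = 2 ^ 1 := rfl
      _ ≤ _ := Nat.pow_le_pow_right (by norm_num) (by omega)
  have hexp : E + (E * (E * E) + E) + E ≤ 2 ^ (2 ^ (11 * e ^ 2)) := by
    have h1 : E + (E * (E * E) + E) + E ≤ E ^ 4 := by
      nlinarith [Nat.mul_le_mul hE4 hE4, Nat.mul_le_mul_right (E * E) hE4,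
        Nat.mul_le_mul_right (E * E * E) hE4]
    refine h1.trans ?_
    rw [hE, ← pow_mul]
    refine Nat.pow_le_pow_right (by norm_num) ?_
    calc 2 ^ (9 * e) * 4 = 2 ^ (9 * e + 2) := by ring
      _ ≤ _ := Nat.pow_le_pow_right (by norm_num) (by nlinarith)
  have hpow : n ^ (D * D) ≤ 2 ^ (E * (E * E)) := by
    calc n ^ (D * D) ≤ (2 ^ E) ^ (D * D) := Nat.pow_le_pow_left ((hne.trans heE).trans (hlt E)) _
      _ ≤ (2 ^ E) ^ (E * E) := Nat.pow_le_pow_right (by positivity) (Nat.mul_le_mul hDE hDE)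
      _ = _ := by rw [← pow_mul]
  rw [← he]
  calc (D + 1) * (n ^ (D * D) * D) * k
      ≤ 2 ^ E * (2 ^ (E * (E * E)) * 2 ^ E) * 2 ^ E := by
        refine Nat.mul_le_mul (Nat.mul_le_mul ?_ (Nat.mul_le_mul hpow (hDE.trans (hlt E))))
          ((hke.trans heE).trans (hlt E))
        calc D + 1 ≤ E + 1 := by omega
          _ ≤ 2 ^ E := E.lt_two_pow_self
    _ = 2 ^ (E + (E * (E * E) + E) + E) := by rw [← pow_add, ← pow_add, ← pow_add]
    _ ≤ _ := Nat.pow_le_pow_right (by norm_num) hexp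

lemma card_indexedMatrix_le {A : Type*} [Finite A] (D : ℕ) (hA : 1 ≤ Nat.card A) :
    Finite {X : IndexedMatrix A // X.dim ≤ D} ∧
      Nat.card {X : IndexedMatrix A // X.dim ≤ D} ≤ (D + 1) * (Nat.card A ^ (D * D) * D) := by
  let e : {X : IndexedMatrix A // X.dim ≤ D} →
      Σ d : Fin (D + 1), (Fin d × Fin d → A) × Fin d :=
    fun X => ⟨⟨X.1.dim, Nat.lt_succ_of_le X.2⟩, fun x => X.1.matrix x.1 x.2, X.1.index⟩
  have he : Function.Injective e := by
    rintro ⟨⟨d, B, i⟩, hd⟩ ⟨⟨d', B', i'⟩, hd'⟩ h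
    simp only [e, Sigma.mk.injEq, Fin.mk.injEq] at h
    obtain ⟨rfl, h⟩ := h
    simp only [heq_eq_eq, Prod.mk.injEq] at h
    obtain ⟨h, rfl⟩ := h
    obtain rfl : B = B' := by
      ext a b
      exact congrFun h (a, b)
    rfl
  refine ⟨Finite.of_injective e he, (Nat.card_le_card_of_injective e he).trans ?_⟩
  rw [Nat.card_sigma]
  refine (Finset.sum_le_card_nsmul _ _ (Nat.card A ^ (D * D) * D) fun d _ => ?_).trans (by simp)
  have hd : (d : ℕ) ≤ D := by omega
  rw [Nat.card_prod, Nat.card_fun]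
  simp only [Nat.card_prod, Nat.card_fin]
  exact Nat.mul_le_mul (Nat.pow_le_pow_right hA (Nat.mul_le_mul hd hd)) hd

section Matrices

variable {Γ Q : Type*} [LinearOrder Γ] [Fintype Γ] {R : DFA (Γ × Γ) Q}

/-- The indexed matrix of a history. -/
noncomputable def indexedMatrix (hR : IsIndistinguishability (recognisedRel R)) (τ : List Γ) :
    IndexedMatrix (MinState R) :=
  (exists_isIndexedMatrixOf hR τ).choose

lemma isIndexedMatrixOf_indexedMatrix (hR : IsIndistinguishability (recognisedRel R))
    (τ : List Γ) : IsIndexedMatrixOf R τ (indexedMatrix hR τ) :=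
  (exists_isIndexedMatrixOf hR τ).choose_spec

lemma indexedMatrix_concat (hR : IsIndistinguishability (recognisedRel R)) {τ τ' : List Γ}
    (h : indexedMatrix hR τ = indexedMatrix hR τ') (a : Γ) :
    indexedMatrix hR (τ ++ [a]) = indexedMatrix hR (τ' ++ [a]) :=
  ((isIndexedMatrixOf_indexedMatrix hR τ).concat hR
    (h ▸ isIndexedMatrixOf_indexedMatrix hR τ') (isIndexedMatrixOf_indexedMatrix hR _)).unique
    (isIndexedMatrixOf_indexedMatrix hR _)

theorem card_range_indexedMatrix_le [Fintype Q] (hR : IsIndistinguishability (recognisedRel R))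
    (hb : BoundedBranching hR.setoid) (hk : 1 ≤ Fintype.card Γ) :
    (Set.range (indexedMatrix hR)).Finite ∧
      (Set.range (indexedMatrix hR)).ncard * Fintype.card Γ ≤
        2 ^ (2 ^ (2 ^ (11 * (Fintype.card Q * (Fintype.card Γ * Fintype.card Γ)) ^ 2))) ∧
      ∀ τ, (classMinima R τ).ncard * Fintype.card Γ ≤
        2 ^ (2 ^ (2 ^ (11 * (Fintype.card Q * (Fintype.card Γ * Fintype.card Γ)) ^ 2))) := by
  have hn : 1 ≤ Fintype.card Q := Fintype.card_pos_iff.2 ⟨R.start⟩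
  have hA : Nat.card (MinState R) ≤ Fintype.card Q := by
    rw [← Nat.card_eq_fintype_card]
    exact Nat.card_le_card_of_surjective _ Quotient.mk_surjective
  have hA1 : 1 ≤ Nat.card (MinState R) := by
    have : Nonempty (MinState R) := ⟨Quotient.mk _ R.start⟩
    exact Nat.card_pos
  obtain ⟨m, hm⟩ : ∃ m, Fintype.card Q * (Fintype.card Q * 2 ^ Fintype.card Q) = m := ⟨_, rfl⟩
  obtain ⟨D, hD⟩ : ∃ D, D = m * (1 + m * (m * (4 ^ m * Fintype.card Γ))) ^ m := ⟨_, rfl⟩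
  have hdim : ∀ τ, (classMinima R τ).ncard ≤ D := fun τ => hD ▸ ncard_classMinima_le hR hb hm τ
  have hbound := card_bound_le hn hk hm hD
  obtain ⟨hfin, hcard⟩ := card_indexedMatrix_le (A := MinState R) D hA1
  have hsub : Set.range (indexedMatrix hR) ⊆ {X : IndexedMatrix (MinState R) | X.dim ≤ D} := by
    rintro _ ⟨τ, rfl⟩
    exact (isIndexedMatrixOf_indexedMatrix hR τ).dim_eq.trans_le (hdim τ)
  have hfin' : {X : IndexedMatrix (MinState R) | X.dim ≤ D}.Finite := hfin
  have hpow : Nat.card (MinState R) ^ (D * D) ≤ Fintype.card Q ^ (D * D) :=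
    Nat.pow_le_pow_left hA _
  refine ⟨hfin'.subset hsub, ?_, fun τ => ?_⟩
  · refine (Nat.mul_le_mul_right _ ?_).trans hbound
    exact ((Set.ncard_le_ncard hsub hfin').trans hcard).trans
      (Nat.mul_le_mul_left _ (Nat.mul_le_mul_right _ hpow))
  · refine (Nat.mul_le_mul_right _ ((hdim τ).trans ?_)).trans hbound
    have h1 : 1 ≤ Fintype.card Q ^ (D * D) := Nat.pos_of_ne_zero (by positivity)
    calc D = 1 * (1 * D) := by ring
      _ ≤ _ := Nat.mul_le_mul (by omega) (Nat.mul_le_mul_right _ h1)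

/-- The indexed matrices are the states of a deterministic automaton, so that each of them is
attained by a word whose length is less than their number. -/
lemma exists_short_indexedMatrix (hR : IsIndistinguishability (recognisedRel R))
    (hfin : (Set.range (indexedMatrix hR)).Finite) (τ : List Γ) :
    ∃ τ', τ'.length < (Set.range (indexedMatrix hR)).ncard ∧
      indexedMatrix hR τ' = indexedMatrix hR τ := by
  have := hfin.fintype
  let A : DFA Γ (Set.range (indexedMatrix hR)) :=
    { step := fun X a => ⟨indexedMatrix hR (X.2.choose ++ [a]), _, rfl⟩
      start := ⟨indexedMatrix hR [], _, rfl⟩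
      accept := ∅ }
  have hA : ∀ τ, (A.evalFrom A.start τ).1 = indexedMatrix hR τ := by
    intro τ
    induction τ using List.reverseRecOn with
    | nil => rfl
    | append_singleton τ a ih =>
      rw [DFA.evalFrom_append_singleton]
      exact indexedMatrix_concat hR ((A.evalFrom A.start τ).2.choose_spec.trans ih) a
  obtain ⟨y, hy, hyτ⟩ := exists_short_word A A.start τ
  refine ⟨y, ?_, ?_⟩
  · rwa [← Nat.card_coe_set_eq, Nat.card_eq_fintype_card]
  · rw [← hA, ← hA, hyτ]

end Matrices

/-! ### Primitive recursive functions by composition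

The lemmas of this part are stated for functions of an arbitrary argument, so that `fun_prop` proves
that a function built from them is primitive recursive by following its definition. -/

attribute [fun_prop] Primrec

section Primrec

variable {α β γ : Type} [Primcodable α] [Primcodable β] [Primcodable γ]

@[fun_prop] lemma primrec_id : Primrec (fun x : α => x) := Primrec.id

@[fun_prop] lemma primrec_const (y : β) : Primrec (fun _ : α => y) := Primrec.const y

@[fun_prop] lemma primrec_comp {f : β → γ} {g : α → β} (hf : Primrec f) (hg : Primrec g) :
    Primrec (fun x => f (g x)) := hf.comp hg

@[fun_prop] lemma primrec_fst {f : α → β × γ} (hf : Primrec f) : Primrec (fun x => (f x).1) :=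
  Primrec.fst.comp hf

@[fun_prop] lemma primrec_snd {f : α → β × γ} (hf : Primrec f) : Primrec (fun x => (f x).2) :=
  Primrec.snd.comp hf

@[fun_prop] lemma primrec_mk {f : α → β} {g : α → γ} (hf : Primrec f) (hg : Primrec g) :
    Primrec (fun x => (f x, g x)) := hf.pair hg

@[fun_prop] lemma primrec_add {f g : α → ℕ} (hf : Primrec f) (hg : Primrec g) :
    Primrec (fun x => f x + g x) := Primrec.nat_add.comp hf hg

@[fun_prop] lemma primrec_sub {f g : α → ℕ} (hf : Primrec f) (hg : Primrec g) :
    Primrec (fun x => f x - g x) := Primrec.nat_sub.comp hf hg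

@[fun_prop] lemma primrec_mul {f g : α → ℕ} (hf : Primrec f) (hg : Primrec g) :
    Primrec (fun x => f x * g x) := Primrec.nat_mul.comp hf hg

@[fun_prop] lemma primrec_div {f g : α → ℕ} (hf : Primrec f) (hg : Primrec g) :
    Primrec (fun x => f x / g x) := Primrec.nat_div.comp hf hg

@[fun_prop] lemma primrec_mod {f g : α → ℕ} (hf : Primrec f) (hg : Primrec g) :
    Primrec (fun x => f x % g x) := Primrec.nat_mod.comp hf hg

@[fun_prop] lemma primrec_pow {f g : α → ℕ} (hf : Primrec f) (hg : Primrec g) :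
    Primrec (fun x => f x ^ g x) :=
  (Primrec₂.unpaired'.1 Nat.Primrec.pow).comp hf hg

@[fun_prop] lemma primrec_unpair {f : α → ℕ} (hf : Primrec f) :
    Primrec (fun x => (f x).unpair) := Primrec.unpair.comp hf

@[fun_prop] lemma primrec_natRec {n : α → ℕ} {f : α → β} {g : α → ℕ → β → β} (hn : Primrec n)
    (hf : Primrec f) (hg : Primrec fun x : α × ℕ × β => g x.1 x.2.1 x.2.2) :
    Primrec (fun x => Nat.rec (motive := fun _ => β) (f x) (g x) (n x)) :=
  Primrec.nat_rec' (h := fun x y => g x y.1 y.2) hn hf hg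

@[fun_prop] lemma primrec_decide_lt {f g : α → ℕ} (hf : Primrec f) (hg : Primrec g) :
    Primrec (fun x => decide (f x < g x)) :=
  (primrecRel_iff_primrec_decide.1 Primrec.nat_lt).comp hf hg

@[fun_prop] lemma primrec_decide_le {f g : α → ℕ} (hf : Primrec f) (hg : Primrec g) :
    Primrec (fun x => decide (f x ≤ g x)) :=
  (primrecRel_iff_primrec_decide.1 Primrec.nat_le).comp hf hg

@[fun_prop] lemma primrec_decide_eq [DecidableEq β] {f g : α → β} (hf : Primrec f)
    (hg : Primrec g) : Primrec (fun x => decide (f x = g x)) :=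
  (primrecRel_iff_primrec_decide.1 Primrec.eq).comp hf hg

@[fun_prop] lemma primrec_and {f g : α → Bool} (hf : Primrec f) (hg : Primrec g) :
    Primrec (fun x => f x && g x) := Primrec.and.comp hf hg

@[fun_prop] lemma primrec_or {f g : α → Bool} (hf : Primrec f) (hg : Primrec g) :
    Primrec (fun x => f x || g x) := Primrec.or.comp hf hg

@[fun_prop] lemma primrec_not {f : α → Bool} (hf : Primrec f) :
    Primrec (fun x => !f x) := Primrec.not.comp hf

@[fun_prop] lemma primrec_length {f : α → List β} (hf : Primrec f) :
    Primrec (fun x => (f x).length) := Primrec.list_length.comp hf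

@[fun_prop] lemma primrec_range {f : α → ℕ} (hf : Primrec f) :
    Primrec (fun x => List.range (f x)) := Primrec.list_range.comp hf

@[fun_prop] lemma primrec_getD {f : α → List β} {g : α → ℕ} {d : β} (hf : Primrec f)
    (hg : Primrec g) : Primrec (fun x => (f x).getD (g x) d) :=
  (Primrec.list_getD d).comp hf hg

@[fun_prop] lemma primrec_map {f : α → List β} {g : α → β → γ} (hf : Primrec f)
    (hg : Primrec fun x : α × β => g x.1 x.2) : Primrec (fun x => (f x).map (g x)) :=
  Primrec.list_map hf hg

@[fun_prop] lemma primrec_flatMap {f : α → List β} {g : α → β → List γ} (hf : Primrec f)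
    (hg : Primrec fun x : α × β => g x.1 x.2) : Primrec (fun x => (f x).flatMap (g x)) :=
  Primrec.list_flatMap hf hg

@[fun_prop] lemma primrec_findIdx {f : α → List β} {p : α → β → Bool} (hf : Primrec f)
    (hp : Primrec fun x : α × β => p x.1 x.2) : Primrec (fun x => (f x).findIdx (p x)) :=
  Primrec.list_findIdx hf hp

@[fun_prop] lemma primrec_filter {f : α → List β} {p : α → β → Bool} (hf : Primrec f)
    (hp : Primrec fun x : α × β => p x.1 x.2) : Primrec (fun x => (f x).filter (p x)) := by
  refine (Primrec.list_flatMap (g := fun x b => bif p x b then [b] else []) hf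
    (Primrec.cond hp ?_ (Primrec.const []))).of_eq fun x => ?_
  · exact Primrec.list_cons.comp Primrec.snd (Primrec.const [])
  · induction f x with
    | nil => rfl
    | cons b l ih =>
      rw [List.flatMap_cons, ih, List.filter_cons]
      cases p x b <;> rfl

@[fun_prop] lemma primrec_all {f : α → List β} {p : α → β → Bool} (hf : Primrec f)
    (hp : Primrec fun x : α × β => p x.1 x.2) : Primrec (fun x => (f x).all (p x)) := by
  have : Primrec fun x => decide (((f x).filter fun b => !p x b).length = 0) := by fun_prop
  refine this.of_eq fun x => ?_
  rw [Bool.eq_iff_iff]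
  simp

end Primrec

/-! ### The construction on descriptions of automata

A word of length `ℓ` over the letters `0, …, k - 1` is represented by the number less than `k ^ ℓ`
of which it is the expansion in base `k`, most significant digit first, so that the lexicographic
order on the words of the same length becomes the order on numbers. A word of any length is
represented by the pair of its length and this number. -/

/-- Acceptance of a state of a described automaton. -/
def acceptCode (c : DFACode) (q : ℕ) : Bool := c.2.2.2.1.getD q false

/-- The transition function of a described automaton. -/
def stepCode (c : DFACode) (q a b : ℕ) : ℕ := ((c.2.2.2.2.getD q []).getD a []).getD b 0

/-- The state reached from `q` on the pair of the words of length `ℓ` numbered `i` and `j`. -/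
def evalCode (c : DFACode) (q ℓ i j : ℕ) : ℕ :=
  Nat.rec (motive := fun _ => ℕ) q (fun t s =>
    stepCode c s (i / c.1 ^ (ℓ - 1 - t) % c.1) (j / c.1 ^ (ℓ - 1 - t) % c.1)) ℓ

/-- Two states accept the same words of length at most `n ^ 2`. -/
def equivCode (c : DFACode) (q q' : ℕ) : Bool :=
  (List.range (c.2.1 * c.2.1 + 1)).all fun ℓ => (List.range (c.1 ^ ℓ)).all fun i =>
    (List.range (c.1 ^ ℓ)).all fun j =>
      decide (acceptCode c (evalCode c q ℓ i j) = acceptCode c (evalCode c q' ℓ i j))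

/-- The least state that is equivalent to `q`. -/
def reprCode (c : DFACode) (q : ℕ) : ℕ :=
  (List.range c.2.1).findIdx fun q' => equivCode c q' q

/-- The state of the minimised automaton reached on a pair of words, as the least of the equivalent
states. -/
def pairCode (c : DFACode) (ℓ i j : ℕ) : ℕ := reprCode c (evalCode c c.2.2.1 ℓ i j)

/-- The recognised relation on words of length `ℓ`. -/
def relCode (c : DFACode) (ℓ i j : ℕ) : Bool := acceptCode c (evalCode c c.2.2.1 ℓ i j)

/-- Interchangeability of words of length `ℓ`. -/
def interCode (c : DFACode) (ℓ i j : ℕ) : Bool :=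
  (List.range (c.1 ^ ℓ)).all fun π => decide (pairCode c ℓ i π = pairCode c ℓ j π)

/-- The increasing list of the least members of the interchangeability classes in an information
set. -/
def minimaCode (c : DFACode) (ℓ i : ℕ) : List ℕ :=
  (List.range (c.1 ^ ℓ)).filter fun ρ => relCode c ℓ i ρ &&
    (List.range (c.1 ^ ℓ)).all fun ρ' => !interCode c ℓ ρ' ρ || decide (ρ ≤ ρ')

/-- The indexed matrix of the word with length `z.1` and number `z.2`. -/
def keyCode (c : DFACode) (z : ℕ × ℕ) : List (List ℕ) × ℕ :=
  ((minimaCode c z.1 z.2).map fun i => (minimaCode c z.1 z.2).map fun j => pairCode c z.1 i j,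
    (minimaCode c z.1 z.2).findIdx fun i => interCode c z.1 i z.2)

/-- The triply exponential bound, which serves three times: it bounds the number of transitions of
the Mealy automaton, the length of the words that represent its states, and the observations. -/
def boundCode (c : DFACode) : ℕ := 2 ^ (2 ^ (2 ^ (11 * (c.2.1 * (c.1 * c.1)) ^ 2)))

/-- The number represents a word. -/
def validCode (c : DFACode) (z : ℕ) : Bool := decide (z.unpair.2 < c.1 ^ z.unpair.1)

/-- The words that serve as states: each is the first one with its indexed matrix, in the order of
the representing numbers. The range suffices for all words of length at most `boundCode c`. -/
def statesCode (c : DFACode) : List ℕ :=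
  (List.range ((boundCode c + (c.1 + 1) ^ boundCode c + 1) ^ 2)).filter fun z =>
    validCode c z && (List.range z).all fun y =>
      !validCode c y || !decide (keyCode c y.unpair = keyCode c z.unpair)

/-- The state reached on a word: the place in the list of states of the word with the same indexed
matrix. -/
def indexCode (c : DFACode) (z : ℕ × ℕ) : ℕ :=
  (statesCode c).findIdx fun y => decide (keyCode c y.unpair = keyCode c z)

/-- The observation at the extension of a word by a letter `a`: in the list of the one-letter
extensions of the least members in the information set of the word, the place of the first one that
is related to the extension by `a`. -/
def outputCode (c : DFACode) (z : ℕ × ℕ) (a : ℕ) : ℕ :=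
  ((minimaCode c z.1 z.2).flatMap fun i => (List.range c.1).map fun b => i * c.1 + b).findIdx
    fun σ => relCode c (z.1 + 1) σ (z.2 * c.1 + a)

/-- The Mealy automaton of a two-tape automaton. -/
def construction (c : DFACode) : MealyCode :=
  (c.1, boundCode c, (statesCode c).length, indexCode c (0, 0),
    (statesCode c).map (fun z => (List.range c.1).map fun a =>
      indexCode c (z.unpair.1 + 1, z.unpair.2 * c.1 + a)),
    (statesCode c).map fun z => (List.range c.1).map fun a => outputCode c z.unpair a)

section Primrec

variable {α : Type} [Primcodable α] {c : α → DFACode} {f g h l : α → ℕ} {z : α → ℕ × ℕ}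

@[fun_prop] lemma primrec_acceptCode (hc : Primrec c) (hf : Primrec f) :
    Primrec fun x => acceptCode (c x) (f x) := by
  unfold acceptCode; fun_prop

@[fun_prop] lemma primrec_stepCode (hc : Primrec c) (hf : Primrec f) (hg : Primrec g)
    (hh : Primrec h) : Primrec fun x => stepCode (c x) (f x) (g x) (h x) := by
  unfold stepCode; fun_prop

@[fun_prop] lemma primrec_evalCode (hc : Primrec c) (hl : Primrec l) (hf : Primrec f)
    (hg : Primrec g) (hh : Primrec h) :
    Primrec fun x => evalCode (c x) (l x) (f x) (g x) (h x) := by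
  unfold evalCode; fun_prop

@[fun_prop] lemma primrec_equivCode (hc : Primrec c) (hf : Primrec f) (hg : Primrec g) :
    Primrec fun x => equivCode (c x) (f x) (g x) := by
  unfold equivCode; fun_prop

@[fun_prop] lemma primrec_reprCode (hc : Primrec c) (hf : Primrec f) :
    Primrec fun x => reprCode (c x) (f x) := by
  unfold reprCode; fun_prop

@[fun_prop] lemma primrec_pairCode (hc : Primrec c) (hf : Primrec f) (hg : Primrec g)
    (hh : Primrec h) : Primrec fun x => pairCode (c x) (f x) (g x) (h x) := by
  unfold pairCode; fun_prop

@[fun_prop] lemma primrec_relCode (hc : Primrec c) (hf : Primrec f) (hg : Primrec g)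
    (hh : Primrec h) : Primrec fun x => relCode (c x) (f x) (g x) (h x) := by
  unfold relCode; fun_prop

@[fun_prop] lemma primrec_interCode (hc : Primrec c) (hf : Primrec f) (hg : Primrec g)
    (hh : Primrec h) : Primrec fun x => interCode (c x) (f x) (g x) (h x) := by
  unfold interCode; fun_prop

@[fun_prop] lemma primrec_minimaCode (hc : Primrec c) (hf : Primrec f) (hg : Primrec g) :
    Primrec fun x => minimaCode (c x) (f x) (g x) := by
  unfold minimaCode; fun_prop

@[fun_prop] lemma primrec_keyCode (hc : Primrec c) (hz : Primrec z) :
    Primrec fun x => keyCode (c x) (z x) := by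
  unfold keyCode; fun_prop

@[fun_prop] lemma primrec_boundCode (hc : Primrec c) : Primrec fun x => boundCode (c x) := by
  unfold boundCode; fun_prop

@[fun_prop] lemma primrec_validCode (hc : Primrec c) (hf : Primrec f) :
    Primrec fun x => validCode (c x) (f x) := by
  unfold validCode; fun_prop

@[fun_prop] lemma primrec_statesCode (hc : Primrec c) : Primrec fun x => statesCode (c x) := by
  unfold statesCode; fun_prop

@[fun_prop] lemma primrec_indexCode (hc : Primrec c) (hz : Primrec z) :
    Primrec fun x => indexCode (c x) (z x) := by
  unfold indexCode; fun_prop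

@[fun_prop] lemma primrec_outputCode (hc : Primrec c) (hz : Primrec z) (hf : Primrec f) :
    Primrec fun x => outputCode (c x) (z x) (f x) := by
  unfold outputCode; fun_prop

theorem primrec_construction : Primrec construction := by
  unfold construction; fun_prop

end Primrec

/-! ### Numbering the words of a given length -/

section Number

variable {k : ℕ}

/-- The number of which a word is the expansion in base `k`, most significant digit first. -/
def wordNumber (τ : List (Fin k)) : ℕ := τ.foldl (fun x a => x * k + a) 0

@[simp] lemma wordNumber_nil : wordNumber ([] : List (Fin k)) = 0 := rfl

lemma wordNumber_concat (τ : List (Fin k)) (a : Fin k) :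
    wordNumber (τ ++ [a]) = wordNumber τ * k + a := by
  simp [wordNumber]

lemma wordNumber_concat_div (τ : List (Fin k)) (a : Fin k) :
    wordNumber (τ ++ [a]) / k = wordNumber τ := by
  have hk : 0 < k := a.pos
  rw [wordNumber_concat, Nat.add_comm, Nat.add_mul_div_right _ _ hk, Nat.div_eq_of_lt a.2,
    Nat.zero_add]

lemma wordNumber_concat_mod (τ : List (Fin k)) (a : Fin k) :
    wordNumber (τ ++ [a]) % k = a := by
  rw [wordNumber_concat, Nat.add_comm, Nat.add_mul_mod_self_right, Nat.mod_eq_of_lt a.2]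

lemma wordNumber_lt (τ : List (Fin k)) : wordNumber τ < k ^ τ.length := by
  induction τ using List.reverseRecOn with
  | nil => simp
  | append_singleton τ a ih =>
    rw [wordNumber_concat, List.length_append, List.length_singleton, pow_succ]
    calc wordNumber τ * k + a < wordNumber τ * k + k := Nat.add_lt_add_left a.2 _
      _ = (wordNumber τ + 1) * k := by ring
      _ ≤ _ := Nat.mul_le_mul_right _ ih

lemma wordNumber_lt_wordNumber {τ τ' : List (Fin k)} (hlen : τ.length = τ'.length)
    (h : τ < τ') : wordNumber τ < wordNumber τ' := by
  induction τ using List.reverseRecOn generalizing τ' with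
  | nil =>
    obtain rfl : τ' = [] := List.length_eq_zero_iff.1 hlen.symm
    exact absurd h (lt_irrefl _)
  | append_singleton τ a ih =>
    rcases List.eq_nil_or_concat τ' with rfl | ⟨τ', b, rfl⟩
    · simp at hlen
    rw [List.concat_eq_append] at h hlen ⊢
    have hlen' : τ.length = τ'.length := by simpa using hlen
    rw [wordNumber_concat, wordNumber_concat]
    rcases (concat_lt_concat_iff hlen' a b).1 h with h | ⟨rfl, hab⟩
    · calc wordNumber τ * k + a < (wordNumber τ + 1) * k := by
            rw [Nat.add_mul, Nat.one_mul]; exact Nat.add_lt_add_left a.2 _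
        _ ≤ wordNumber τ' * k := Nat.mul_le_mul_right _ (ih hlen' h)
        _ ≤ _ := Nat.le_add_right _ _
    · exact Nat.add_lt_add_left hab _

lemma wordNumber_le_iff {τ τ' : List (Fin k)} (hlen : τ.length = τ'.length) :
    wordNumber τ ≤ wordNumber τ' ↔ τ ≤ τ' := by
  rcases lt_trichotomy τ τ' with h | rfl | h
  · exact iff_of_true (wordNumber_lt_wordNumber hlen h).le h.le
  · simp
  · exact iff_of_false (not_le.2 (wordNumber_lt_wordNumber hlen.symm h)) (not_le.2 h)

lemma exists_wordNumber (ℓ i : ℕ) (h : i < k ^ ℓ) :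
    ∃ τ : List (Fin k), τ.length = ℓ ∧ wordNumber τ = i := by
  induction ℓ generalizing i with
  | zero => exact ⟨[], rfl, by simpa [eq_comm] using h⟩
  | succ ℓ ih =>
    have hk : 0 < k := Nat.pos_of_ne_zero fun h0 => by simp [h0] at h
    obtain ⟨τ, hτ, hi⟩ := ih (i / k) (Nat.div_lt_of_lt_mul (by rwa [pow_succ'] at h))
    refine ⟨τ ++ [⟨i % k, Nat.mod_lt _ hk⟩], by simp [hτ], ?_⟩
    rw [wordNumber_concat, hi]
    exact Nat.div_add_mod' i k

/-- Bounded quantification over the numbers of words is quantification over words. -/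
lemma all_range_iff {ℓ : ℕ} {p : ℕ → Bool} :
    (List.range (k ^ ℓ)).all p = true ↔
      ∀ τ : List (Fin k), τ.length = ℓ → p (wordNumber τ) = true := by
  rw [List.all_eq_true]
  constructor
  · rintro h τ rfl
    exact h _ (List.mem_range.2 (wordNumber_lt τ))
  · intro h i hi
    obtain ⟨τ, hτ, rfl⟩ := exists_wordNumber ℓ i (List.mem_range.1 hi)
    exact h τ hτ

end Number

/-! ### The codes compute what they stand for -/

lemma findIdx_congr_mem {α : Type*} {p q : α → Bool} {l : List α} (h : ∀ x ∈ l, p x = q x) :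
    l.findIdx p = l.findIdx q := by
  induction l with
  | nil => rfl
  | cons a l ih =>
    rw [List.findIdx_cons, List.findIdx_cons, h a List.mem_cons_self,
      ih fun x hx => h x (List.mem_cons_of_mem _ hx)]

section Spec

variable {k n : ℕ} (R : DFA (Fin k × Fin k) (Fin n))

lemma acceptCode_dfaCode (q : Fin n) : acceptCode (dfaCode R) q = true ↔ q ∈ R.accept := by
  simp [acceptCode, dfaCode]

lemma stepCode_dfaCode (q : Fin n) (a b : Fin k) :
    stepCode (dfaCode R) q a b = R.step q (a, b) := by
  simp [stepCode, dfaCode]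

lemma evalCode_dfaCode (q : Fin n) {τ τ' : List (Fin k)} (h : τ.length = τ'.length) :
    evalCode (dfaCode R) q τ.length (wordNumber τ) (wordNumber τ') =
      R.evalFrom q (τ.zip τ') := by
  induction τ using List.reverseRecOn generalizing τ' with
  | nil => simp [evalCode]
  | append_singleton τ a ih =>
    rcases List.eq_nil_or_concat τ' with rfl | ⟨τ', b, rfl⟩
    · simp at h
    rw [List.concat_eq_append] at h ⊢
    have h' : τ.length = τ'.length := by simpa using h
    have hk : (dfaCode R).1 = k := rfl
    -- the digits of the prefixes are the leading digits
    have digit : ∀ (ρ : List (Fin k)) (c : Fin k) (t : ℕ), t < τ.length →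
        wordNumber (ρ ++ [c]) / k ^ (τ.length + 1 - 1 - t) =
          wordNumber ρ / k ^ (τ.length - 1 - t) := by
      intro ρ c t ht
      rw [show τ.length + 1 - 1 - t = (τ.length - 1 - t) + 1 by omega, pow_succ',
        ← Nat.div_div_eq_div_mul, wordNumber_concat_div]
    have prefix_eq : ∀ t ≤ τ.length,
        Nat.rec (motive := fun _ => ℕ) (q : ℕ) (fun t s => stepCode (dfaCode R) s
          (wordNumber (τ ++ [a]) / k ^ (τ.length + 1 - 1 - t) % k)
          (wordNumber (τ' ++ [b]) / k ^ (τ.length + 1 - 1 - t) % k)) t =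
        Nat.rec (motive := fun _ => ℕ) (q : ℕ) (fun t s => stepCode (dfaCode R) s
          (wordNumber τ / k ^ (τ.length - 1 - t) % k)
          (wordNumber τ' / k ^ (τ.length - 1 - t) % k)) t := by
      intro t
      induction t with
      | zero => intro _; rfl
      | succ t iht =>
        intro ht
        simp only
        rw [iht (by omega), digit τ a t (by omega), digit τ' b t (by omega)]
    have ih' := ih h'
    simp only [evalCode, hk] at ih' ⊢
    rw [List.length_append, List.length_singleton]
    simp only
    rw [prefix_eq _ le_rfl, ih', List.zip_append h', DFA.evalFrom_of_append]
    simp only [Nat.add_sub_cancel, Nat.sub_self, pow_zero, Nat.div_one, wordNumber_concat_mod]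
    rw [stepCode_dfaCode]
    simp

/-- Inequivalent states are told apart by a word of length at most `n ^ 2`: a shortest one does not
repeat a pair of states. -/
lemma equivCode_dfaCode (q q' : Fin n) :
    equivCode (dfaCode R) q q' = true ↔ R.acceptsFrom q = R.acceptsFrom q' := by
  have hk : (dfaCode R).1 = k := rfl
  have hn : (dfaCode R).2.1 = n := rfl
  have key : ∀ u u' : List (Fin k), u.length = u'.length →
      (acceptCode (dfaCode R) (evalCode (dfaCode R) q u.length (wordNumber u) (wordNumber u')) =
        acceptCode (dfaCode R) (evalCode (dfaCode R) q' u.length (wordNumber u) (wordNumber u')) ↔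
      (u.zip u' ∈ R.acceptsFrom q ↔ u.zip u' ∈ R.acceptsFrom q')) := by
    intro u u' hu
    rw [Bool.eq_iff_iff, evalCode_dfaCode R q hu, evalCode_dfaCode R q' hu, acceptCode_dfaCode,
      acceptCode_dfaCode]
    rfl
  rw [equivCode, hk, hn, List.all_eq_true]
  constructor
  · intro h
    ext x
    let P : DFA (Fin k × Fin k) (Fin n × Fin n) :=
      { step := fun s a => (R.step s.1 a, R.step s.2 a), start := (q, q'), accept := ∅ }
    have hP : ∀ x, P.evalFrom (q, q') x = (R.evalFrom q x, R.evalFrom q' x) := by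
      intro x
      induction x using List.reverseRecOn with
      | nil => rfl
      | append_singleton x a ih => simp [ih, P]
    obtain ⟨y, hy, hyx⟩ := exists_short_word P (q, q') x
    rw [hP, hP, Prod.mk.injEq] at hyx
    have hlen : y.length < n * n + 1 := by
      simp only [Fintype.card_prod, Fintype.card_fin] at hy
      omega
    have h1 := (all_range_iff.1 (all_range_iff.1 (h _ (List.mem_range.2 hlen))
      (y.map Prod.fst) (by simp))) (y.map Prod.snd) (by simp)
    rw [decide_eq_true_iff] at h1
    have h2 := (key (y.map Prod.fst) (y.map Prod.snd) (by simp)).1 (by simpa using h1)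
    have h3 : (y.map Prod.fst).zip (y.map Prod.snd) = y := by
      rw [← List.unzip_fst, ← List.unzip_snd, List.zip_unzip]
    rw [h3] at h2
    rw [DFA.mem_acceptsFrom, DFA.mem_acceptsFrom] at h2 ⊢
    rwa [hyx.1, hyx.2] at h2
  · intro h ℓ _
    rw [all_range_iff]
    rintro u rfl
    rw [all_range_iff]
    intro u' hu'
    rw [decide_eq_true_iff, key u u' hu'.symm, h]

lemma reprCode_eq_iff (q q' : Fin n) :
    reprCode (dfaCode R) q = reprCode (dfaCode R) q' ↔ R.acceptsFrom q = R.acceptsFrom q' := by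
  have hn : (dfaCode R).2.1 = n := rfl
  -- the representative of a state is a state equivalent to it
  have repr_spec : ∀ q : Fin n, ∃ r : Fin n, reprCode (dfaCode R) q = r ∧
      R.acceptsFrom r = R.acceptsFrom q := by
    intro q
    have hlt : reprCode (dfaCode R) q < (List.range n).length :=
      List.findIdx_lt_length_of_exists
        ⟨q, List.mem_range.2 q.2, (equivCode_dfaCode R q q).2 rfl⟩
    have h : equivCode (dfaCode R) ((List.range n)[reprCode (dfaCode R) q]'hlt) q = true :=
      List.findIdx_getElem (p := fun q' => equivCode (dfaCode R) q' q) (w := hlt)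
    rw [List.getElem_range] at h
    rw [List.length_range] at hlt
    exact ⟨⟨_, hlt⟩, rfl, (equivCode_dfaCode R ⟨_, hlt⟩ q).1 h⟩
  constructor
  · intro h
    obtain ⟨r, hr, hr'⟩ := repr_spec q
    obtain ⟨s, hs, hs'⟩ := repr_spec q'
    obtain rfl : r = s := Fin.ext (hr.symm.trans (h.trans hs))
    exact hr'.symm.trans hs'
  · intro h
    unfold reprCode
    rw [hn]
    refine findIdx_congr_mem fun p hp => ?_
    rw [List.mem_range] at hp
    rw [Bool.eq_iff_iff, equivCode_dfaCode R ⟨p, hp⟩ q, equivCode_dfaCode R ⟨p, hp⟩ q', h]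

end Spec

section Spec

variable {k n : ℕ} {R : DFA (Fin k × Fin k) (Fin n)}

/-- The number of a state of the minimised automaton. -/
noncomputable def stateNumber (R : DFA (Fin k × Fin k) (Fin n)) : MinState R → ℕ :=
  Quotient.lift (fun q : Fin n => reprCode (dfaCode R) q) fun q q' h => (reprCode_eq_iff R q q').2 h

lemma stateNumber_injective : Function.Injective (stateNumber R) := by
  rintro ⟨q⟩ ⟨q'⟩ h
  exact Quotient.sound ((reprCode_eq_iff R q q').1 h)

lemma pairCode_dfaCode {τ τ' : List (Fin k)} (h : τ.length = τ'.length) :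
    pairCode (dfaCode R) τ.length (wordNumber τ) (wordNumber τ') =
      stateNumber R (pairState R τ τ') := by
  have := evalCode_dfaCode R R.start h
  rw [pairCode, show (dfaCode R).2.2.1 = (R.start : ℕ) from rfl, this]
  rfl

lemma relCode_dfaCode {τ τ' : List (Fin k)} (h : τ.length = τ'.length) :
    relCode (dfaCode R) τ.length (wordNumber τ) (wordNumber τ') = true ↔
      recognisedRel R τ τ' := by
  have := evalCode_dfaCode R R.start h
  rw [relCode, show (dfaCode R).2.2.1 = (R.start : ℕ) from rfl, this, acceptCode_dfaCode,
    recognisedRel_iff h]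
  rfl

lemma relCode_concat_dfaCode {τ τ' : List (Fin k)} (h : τ.length = τ'.length) (a b : Fin k) :
    relCode (dfaCode R) (τ.length + 1) (wordNumber τ * k + a) (wordNumber τ' * k + b) = true ↔
      recognisedRel R (τ ++ [a]) (τ' ++ [b]) := by
  rw [← relCode_dfaCode (by simp [h]), wordNumber_concat, wordNumber_concat]
  simp

lemma interCode_dfaCode {τ τ' : List (Fin k)} (h : τ.length = τ'.length) :
    interCode (dfaCode R) τ.length (wordNumber τ) (wordNumber τ') = true ↔
      Interchangeable R τ τ' := by
  rw [interCode, show (dfaCode R).1 = k from rfl, all_range_iff]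
  refine Iff.trans ?_ (and_iff_right h).symm
  refine forall_congr' fun π => forall_congr' fun hπ => ?_
  rw [decide_eq_true_iff, pairCode_dfaCode hπ.symm, h, pairCode_dfaCode (h.symm.trans hπ.symm),
    stateNumber_injective.eq_iff]

lemma minimaCode_dfaCode {τ : List (Fin k)} {d : ℕ} {w : Fin d → List (Fin k)}
    (hw : StrictMono w) (hwr : Set.range w = classMinima R τ) :
    minimaCode (dfaCode R) τ.length (wordNumber τ) = List.ofFn fun i => wordNumber (w i) := by
  have hlen : ∀ i, τ.length = (w i).length := fun i =>
    (hwr ▸ Set.mem_range_self i : w i ∈ classMinima R τ).1.1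
  have hk : (dfaCode R).1 = k := rfl
  refine List.SortedLT.eq_of_mem_iff ((List.pairwise_lt_range).filter _).sortedLT
    (List.sortedLT_ofFn_iff.2 fun i j hij =>
      wordNumber_lt_wordNumber ((hlen i).symm.trans (hlen j)) (hw hij)) fun {x} => ?_
  rw [minimaCode, List.mem_filter, List.mem_range, Bool.and_eq_true, hk, all_range_iff,
    List.mem_ofFn']
  have key : ∀ ρ : List (Fin k), τ.length = ρ.length →
      (relCode (dfaCode R) τ.length (wordNumber τ) (wordNumber ρ) = true ∧
        (∀ ρ' : List (Fin k), ρ'.length = τ.length →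
          (!interCode (dfaCode R) τ.length (wordNumber ρ') (wordNumber ρ) ||
            decide (wordNumber ρ' ≥ wordNumber ρ)) = true) ↔ ρ ∈ classMinima R τ) := by
    intro ρ hρ
    rw [relCode_dfaCode hρ, mem_classMinima]
    refine and_congr_right fun _ => ⟨fun h ρ' hi => ?_, fun h ρ' hρ' => ?_⟩
    · have hl : ρ'.length = τ.length := hi.1.trans hρ.symm
      have := h ρ' hl
      rw [← hl, (interCode_dfaCode hi.1).2 hi] at this
      simpa [wordNumber_le_iff hi.1.symm] using this
    · have hl : ρ'.length = ρ.length := hρ'.trans hρ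
      rw [Bool.or_eq_true, Bool.not_eq_true', decide_eq_true_iff, ge_iff_le,
        wordNumber_le_iff hl.symm, ← hρ', ← Bool.not_eq_true, interCode_dfaCode hl]
      exact (em (Interchangeable R ρ' ρ)).symm.imp id (h ρ')
  constructor
  · rintro ⟨hx, h⟩
    obtain ⟨ρ, hρ, rfl⟩ := exists_wordNumber _ _ hx
    have hmem := (key ρ hρ.symm).1 h
    rw [← hwr] at hmem
    obtain ⟨i, rfl⟩ := hmem
    exact ⟨i, rfl⟩
  · rintro ⟨i, rfl⟩
    exact ⟨by rw [hlen i]; exact wordNumber_lt _,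
      (key (w i) (hlen i)).2 (hwr ▸ Set.mem_range_self i)⟩

/-- The code of an indexed matrix. -/
noncomputable def matrixCode (X : IndexedMatrix (MinState R)) : List (List ℕ) × ℕ :=
  (List.ofFn fun i => List.ofFn fun j => stateNumber R (X.matrix i j), X.index)

lemma matrixCode_injective : Function.Injective (matrixCode (R := R)) := by
  rintro ⟨d, A, i⟩ ⟨e, B, j⟩ h
  simp only [matrixCode, Prod.mk.injEq] at h
  obtain ⟨h1, h2⟩ := h
  obtain rfl : d = e := by simpa using congrArg List.length h1
  obtain rfl : i = j := Fin.ext h2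
  obtain rfl : A = B := by
    ext a b
    have h3 := congrFun (List.ofFn_injective h1) a
    exact stateNumber_injective (congrFun (List.ofFn_injective h3) b)
  rfl

/-- The representation of a word by its length and its number. -/
def wordCode (τ : List (Fin k)) : ℕ × ℕ := (τ.length, wordNumber τ)

lemma keyCode_dfaCode {τ : List (Fin k)} {X : IndexedMatrix (MinState R)}
    (hX : IsIndexedMatrixOf R τ X) : keyCode (dfaCode R) (wordCode τ) = matrixCode X := by
  obtain ⟨w, hw, hwr, hwm, hwi⟩ := hX
  have hmem : ∀ i, w i ∈ classMinima R τ := fun i => hwr ▸ Set.mem_range_self i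
  have hlen : ∀ i, τ.length = (w i).length := fun i => (hmem i).1.1
  simp only [keyCode, wordCode, matrixCode, minimaCode_dfaCode hw hwr, Prod.mk.injEq]
  constructor
  · rw [List.map_ofFn]
    congr 1
    ext1 i
    rw [Function.comp_apply, List.map_ofFn]
    congr 1
    ext1 j
    rw [Function.comp_apply, hwm, hlen i, pairCode_dfaCode ((hlen i).symm.trans (hlen j))]
  · have hint : ∀ i, interCode (dfaCode R) τ.length (wordNumber (w i)) (wordNumber τ) = true ↔
        Interchangeable R (w i) τ := fun i => by
      rw [hlen i, interCode_dfaCode (hlen i).symm]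
    rw [List.findIdx_eq (by simp)]
    simp only [List.getElem_ofFn]
    refine ⟨(hint _).2 hwi, fun j hj => ?_⟩
    rw [← Bool.not_eq_true, hint]
    intro h
    have := hw.injective ((mem_classMinima.1 (hmem _)).2.eq_of_interchangeable
      (mem_classMinima.1 (hmem _)).2 (h.trans hwi.symm))
    rw [← this] at hj
    exact lt_irrefl _ hj

lemma keyCode_eq_iff (hR : IsIndistinguishability (recognisedRel R)) {τ τ' : List (Fin k)} :
    keyCode (dfaCode R) (wordCode τ) = keyCode (dfaCode R) (wordCode τ') ↔
      indexedMatrix hR τ = indexedMatrix hR τ' := by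
  rw [keyCode_dfaCode (isIndexedMatrixOf_indexedMatrix hR τ),
    keyCode_dfaCode (isIndexedMatrixOf_indexedMatrix hR τ'), matrixCode_injective.eq_iff]

/-! ### The observations -/

lemma findIdx_eq_of_map_eq {α β : Type*} {l : List α} {l' : List β} {p : α → Bool} {p' : β → Bool}
    (h : l.map p = l'.map p') : l.findIdx p = l'.findIdx p' := by
  have h1 := List.findIdx_map l p id
  have h2 := List.findIdx_map l' p' id
  rw [Function.id_comp] at h1 h2
  rw [← h1, ← h2, h]

/-- The observation depends only on the indexed matrix. -/
lemma outputCode_congr (hR : IsIndistinguishability (recognisedRel R)) {τ τ' : List (Fin k)}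
    (h : indexedMatrix hR τ = indexedMatrix hR τ') (a : Fin k) :
    outputCode (dfaCode R) (wordCode τ) a = outputCode (dfaCode R) (wordCode τ') a := by
  have hX := isIndexedMatrixOf_indexedMatrix hR τ
  have hX' := isIndexedMatrixOf_indexedMatrix hR τ'
  rw [← h] at hX'
  obtain ⟨w, hw, hwr, hwm, hwi⟩ := hX
  obtain ⟨w', hw', hwr', hwm', hwi'⟩ := hX'
  have hmem : ∀ i, w i ∈ classMinima R τ := fun i => hwr ▸ Set.mem_range_self i
  have hmem' : ∀ i, w' i ∈ classMinima R τ' := fun i => hwr' ▸ Set.mem_range_self i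
  have hlen : ∀ i, τ.length = (w i).length := fun i => (hmem i).1.1
  have hlen' : ∀ i, τ'.length = (w' i).length := fun i => (hmem' i).1.1
  have hk : (dfaCode R).1 = k := rfl
  -- the information set of `τ ++ [a]` meets the extensions of the least members in the same way
  have key : ∀ i (b : Fin k), recognisedRel R (w i ++ [b]) (τ ++ [a]) ↔
      recognisedRel R (w' i ++ [b]) (τ' ++ [a]) := by
    intro i b
    have e : ∀ {ρ ρ' π : List (Fin k)}, Interchangeable R ρ ρ' →
        (recognisedRel R π (ρ' ++ [a]) ↔ recognisedRel R π (ρ ++ [a])) := fun {ρ ρ' π} h =>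
      have h1 := (h.append hR [a]).related hR
      ⟨fun h2 => hR.equivalence.trans h2 (hR.equivalence.symm h1),
        fun h2 => hR.equivalence.trans h2 h1⟩
    rw [e hwi, e hwi']
    have hl := (hlen i).symm.trans (hlen (indexedMatrix hR τ).index)
    have hl' := (hlen' i).symm.trans (hlen' (indexedMatrix hR τ).index)
    exact recognisedRel_congr (by simp [hl]) (by simp [hl'])
      (pairState_append hl hl' rfl ((hwm _ _).symm.trans (hwm' _ _)))
  simp only [outputCode, wordCode, minimaCode_dfaCode hw hwr, minimaCode_dfaCode hw' hwr', hk]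
  apply findIdx_eq_of_map_eq
  rw [List.map_flatMap, List.map_flatMap, List.flatMap_def, List.flatMap_def, List.map_ofFn,
    List.map_ofFn]
  congr 2
  ext1 i
  simp only [Function.comp_apply, List.map_map]
  refine List.map_congr_left fun b hb => ?_
  rw [List.mem_range] at hb
  simp only [Function.comp_apply]
  have h1 := relCode_concat_dfaCode (R := R) (hlen i).symm ⟨b, hb⟩ a
  have h2 := relCode_concat_dfaCode (R := R) (hlen' i).symm ⟨b, hb⟩ a
  rw [← hlen i] at h1
  rw [← hlen' i] at h2
  rw [Bool.eq_iff_iff]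
  exact h1.trans ((key i ⟨b, hb⟩).trans h2.symm)

lemma mem_flatMap_extensions {d : ℕ} {w : Fin d → List (Fin k)} {x : ℕ} :
    x ∈ (List.ofFn fun i => wordNumber (w i)).flatMap
      (fun i => (List.range k).map fun b => i * k + b) ↔
      ∃ i, ∃ b : Fin k, x = wordNumber (w i) * k + b := by
  simp only [List.mem_flatMap, List.mem_ofFn', Set.mem_range, List.mem_map, List.mem_range]
  constructor
  · rintro ⟨_, ⟨i, rfl⟩, b, hb, rfl⟩
    exact ⟨i, ⟨b, hb⟩, rfl⟩
  · rintro ⟨i, b, rfl⟩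
    exact ⟨_, ⟨i, rfl⟩, b, b.2, rfl⟩

/-- At histories in the same information set, the observations agree exactly on extensions that
are in the same information set. -/
lemma outputCode_eq_iff (hR : IsIndistinguishability (recognisedRel R)) {τ τ' : List (Fin k)}
    (h : recognisedRel R τ τ') (a b : Fin k) :
    outputCode (dfaCode R) (wordCode τ) a = outputCode (dfaCode R) (wordCode τ') b ↔
      recognisedRel R (τ ++ [a]) (τ' ++ [b]) := by
  obtain ⟨X, w, hw, hwr, -, hwi⟩ := exists_isIndexedMatrixOf hR τ
  have hwr' : Set.range w = classMinima R τ' := hwr.trans (classMinima_congr hR h)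
  have hlen : ∀ i, τ.length = (w i).length := fun i =>
    (hwr ▸ Set.mem_range_self i : w i ∈ classMinima R τ).1.1
  have hk : (dfaCode R).1 = k := rfl
  simp only [outputCode, wordCode, minimaCode_dfaCode hw hwr, minimaCode_dfaCode hw hwr', hk]
  have h1 : ∀ i (c : Fin k), relCode (dfaCode R) (τ.length + 1) (wordNumber (w i) * k + c)
      (wordNumber τ * k + a) = true ↔ recognisedRel R (w i ++ [c]) (τ ++ [a]) := fun i c => by
    rw [hlen i]; exact relCode_concat_dfaCode (hlen i).symm c a
  have h2 : ∀ i (c : Fin k), relCode (dfaCode R) (τ'.length + 1) (wordNumber (w i) * k + c)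
      (wordNumber τ' * k + b) = true ↔ recognisedRel R (w i ++ [c]) (τ' ++ [b]) := fun i c => by
    rw [← h.1, hlen i]; exact relCode_concat_dfaCode ((hlen i).symm.trans h.1) c b
  constructor
  · intro heq
    have hlt := List.findIdx_lt_length_of_exists (p := fun σ =>
        relCode (dfaCode R) (τ.length + 1) σ (wordNumber τ * k + a))
      ⟨_, mem_flatMap_extensions.2 ⟨X.index, a, rfl⟩,
        (h1 _ _).2 ((hwi.append hR [a]).related hR)⟩
    have hp := List.findIdx_getElem (w := hlt)
    have hp' := List.findIdx_getElem (w := heq ▸ hlt)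
    simp only [← heq] at hp'
    obtain ⟨i, c, hic⟩ := mem_flatMap_extensions.1 (List.getElem_mem hlt)
    rw [hic, h1] at hp
    rw [hic, h2] at hp'
    exact hR.equivalence.trans (hR.equivalence.symm hp) hp'
  · intro hab
    refine findIdx_congr_mem fun σ hσ => ?_
    obtain ⟨i, c, rfl⟩ := mem_flatMap_extensions.1 hσ
    rw [Bool.eq_iff_iff, h1, h2]
    exact ⟨fun h => hR.equivalence.trans h hab,
      fun h => hR.equivalence.trans h (hR.equivalence.symm hab)⟩

lemma outputCode_lt (hR : IsIndistinguishability (recognisedRel R)) (τ : List (Fin k))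
    (a : Fin k) :
    outputCode (dfaCode R) (wordCode τ) a < (classMinima R τ).ncard * k := by
  obtain ⟨X, hX⟩ := exists_isIndexedMatrixOf hR τ
  have hdim := hX.dim_eq
  obtain ⟨w, hw, hwr, -, hwi⟩ := hX
  have hlen : ∀ i, τ.length = (w i).length := fun i =>
    (hwr ▸ Set.mem_range_self i : w i ∈ classMinima R τ).1.1
  have hk : (dfaCode R).1 = k := rfl
  simp only [outputCode, wordCode, minimaCode_dfaCode hw hwr, hk]
  refine (List.findIdx_lt_length_of_exists
    ⟨_, mem_flatMap_extensions.2 ⟨X.index, a, rfl⟩, ?_⟩).trans_le ?_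
  · rw [hlen X.index]
    exact (relCode_concat_dfaCode (hlen _).symm a a).2 ((hwi.append hR [a]).related hR)
  · rw [← hdim]
    simp [List.length_flatMap, Function.comp_def]

end Spec

/-! ### The states -/

section States

variable {k n : ℕ} {R : DFA (Fin k × Fin k) (Fin n)}

lemma boundCode_dfaCode (R : DFA (Fin k × Fin k) (Fin n)) :
    boundCode (dfaCode R) = 2 ^ (2 ^ (2 ^ (11 * (n * (k * k)) ^ 2))) := rfl

lemma validCode_iff {z : ℕ} :
    validCode (dfaCode R) z = true ↔ ∃ τ : List (Fin k), z.unpair = wordCode τ := by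
  rw [validCode, decide_eq_true_iff, show (dfaCode R).1 = k from rfl]
  constructor
  · intro h
    obtain ⟨τ, hτ, hi⟩ := exists_wordNumber _ _ h
    exact ⟨τ, Prod.ext hτ.symm hi.symm⟩
  · rintro ⟨τ, h⟩
    rw [h]
    exact wordNumber_lt τ

lemma mem_statesCode {z : ℕ} :
    z ∈ statesCode (dfaCode R) ↔
      z < (boundCode (dfaCode R) + (k + 1) ^ boundCode (dfaCode R) + 1) ^ 2 ∧
      validCode (dfaCode R) z = true ∧ ∀ y < z, validCode (dfaCode R) y = true →
        keyCode (dfaCode R) y.unpair ≠ keyCode (dfaCode R) z.unpair := by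
  rw [statesCode, List.mem_filter, List.mem_range, Bool.and_eq_true, List.all_eq_true,
    show (dfaCode R).1 = k from rfl]
  refine and_congr_right fun _ => and_congr_right fun _ => forall_congr' fun y => ?_
  rw [List.mem_range, Bool.or_eq_true, Bool.not_eq_true', Bool.not_eq_true',
    decide_eq_false_iff_not, ← Bool.not_eq_true, ← imp_iff_not_or]

lemma eq_of_keyCode_eq {z z' : ℕ} (hz : z ∈ statesCode (dfaCode R))
    (hz' : z' ∈ statesCode (dfaCode R))
    (h : keyCode (dfaCode R) z.unpair = keyCode (dfaCode R) z'.unpair) : z = z' := by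
  rw [mem_statesCode] at hz hz'
  rcases lt_trichotomy z z' with hlt | rfl | hlt
  · exact absurd h (hz'.2.2 z hlt hz.2.1)
  · rfl
  · exact absurd h.symm (hz.2.2 z' hlt hz'.2.1)

/-- Every indexed matrix occurs at a word of length at most `boundCode`. -/
lemma exists_bounded_indexedMatrix (hR : IsIndistinguishability (recognisedRel R))
    (hb : BoundedBranching hR.setoid) (τ : List (Fin k)) :
    ∃ τ' : List (Fin k), τ'.length ≤ boundCode (dfaCode R) ∧
      indexedMatrix hR τ' = indexedMatrix hR τ := by
  rcases Nat.eq_zero_or_pos k with rfl | hk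
  · refine ⟨τ, ?_, rfl⟩
    rcases τ with _ | ⟨a, τ⟩
    · simp
    · exact a.elim0
  · obtain ⟨hfin, hcard, -⟩ := card_range_indexedMatrix_le hR hb (by rwa [Fintype.card_fin])
    obtain ⟨τ', hlt, hτ'⟩ := exists_short_indexedMatrix hR hfin τ
    refine ⟨τ', hlt.le.trans ?_, hτ'⟩
    simp only [Fintype.card_fin] at hcard
    rw [boundCode_dfaCode]
    exact (Nat.le_mul_of_pos_right _ hk).trans hcard

lemma exists_mem_statesCode (hR : IsIndistinguishability (recognisedRel R))
    (hb : BoundedBranching hR.setoid) (τ : List (Fin k)) :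
    ∃ z ∈ statesCode (dfaCode R),
      keyCode (dfaCode R) z.unpair = keyCode (dfaCode R) (wordCode τ) := by
  classical
  obtain ⟨τ', hlen, hτ'⟩ := exists_bounded_indexedMatrix hR hb τ
  rw [← keyCode_eq_iff hR] at hτ'
  let y := Nat.pair (wordCode τ').1 (wordCode τ').2
  have hy : y.unpair = wordCode τ' := Nat.unpair_pair _ _
  let P : ℕ → Prop := fun z => validCode (dfaCode R) z = true ∧
    keyCode (dfaCode R) z.unpair = keyCode (dfaCode R) (wordCode τ)
  have hP : ∃ z, P z := ⟨y, validCode_iff.2 ⟨τ', hy⟩, by rw [hy, hτ']⟩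
  have hle : Nat.find hP ≤ y := Nat.find_min' hP ⟨validCode_iff.2 ⟨τ', hy⟩, by rw [hy, hτ']⟩
  refine ⟨Nat.find hP, mem_statesCode.2 ⟨?_, (Nat.find_spec hP).1, fun y hy hv heq => ?_⟩,
    (Nat.find_spec hP).2⟩
  · refine hle.trans_lt ((Nat.pair_lt_max_add_one_sq _ _).trans_le (Nat.pow_le_pow_left ?_ 2))
    have h1 : (wordCode τ').1 ≤ boundCode (dfaCode R) := hlen
    have h2 : (wordCode τ').2 ≤ (k + 1) ^ boundCode (dfaCode R) :=
      (wordNumber_lt τ').le.trans ((Nat.pow_le_pow_left k.le_succ _).trans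
        (Nat.pow_le_pow_right k.succ_pos hlen))
    omega
  · exact Nat.find_min hP hy ⟨hv, heq.trans (Nat.find_spec hP).2⟩

lemma keyCode_getElem_indexCode {c : DFACode} {z : ℕ × ℕ}
    (h : indexCode c z < (statesCode c).length) :
    keyCode c ((statesCode c)[indexCode c z]).unpair = keyCode c z :=
  of_decide_eq_true (List.findIdx_getElem
    (p := fun y : ℕ => decide (keyCode c y.unpair = keyCode c z)) (w := h))

lemma indexCode_lt (hR : IsIndistinguishability (recognisedRel R))
    (hb : BoundedBranching hR.setoid) (τ : List (Fin k)) :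
    indexCode (dfaCode R) (wordCode τ) < (statesCode (dfaCode R)).length := by
  obtain ⟨z, hz, hkey⟩ := exists_mem_statesCode hR hb τ
  exact List.findIdx_lt_length_of_exists ⟨z, hz, decide_eq_true hkey⟩

lemma exists_stateWord (R : DFA (Fin k × Fin k) (Fin n))
    (p : Fin (statesCode (dfaCode R)).length) :
    ∃ τ : List (Fin k), (statesCode (dfaCode R))[p].unpair = wordCode τ :=
  validCode_iff.1 (mem_statesCode.1 (List.getElem_mem p.2)).2.1

/-- The word that represents a state. -/
noncomputable def stateWord (R : DFA (Fin k × Fin k) (Fin n))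
    (p : Fin (statesCode (dfaCode R)).length) : List (Fin k) :=
  (exists_stateWord R p).choose

lemma unpair_eq_wordCode_stateWord (p : Fin (statesCode (dfaCode R)).length) :
    (statesCode (dfaCode R))[p].unpair = wordCode (stateWord R p) :=
  (exists_stateWord R p).choose_spec

lemma indexedMatrix_stateWord_injective (hR : IsIndistinguishability (recognisedRel R)) :
    Function.Injective fun p => indexedMatrix hR (stateWord R p) := by
  intro p p' h
  dsimp only at h
  rw [← keyCode_eq_iff hR, ← unpair_eq_wordCode_stateWord, ← unpair_eq_wordCode_stateWord] at h
  have h1 := eq_of_keyCode_eq (List.getElem_mem p.2) (List.getElem_mem p'.2) h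
  have hnodup : (statesCode (dfaCode R)).Nodup := List.nodup_range.filter _
  exact Fin.ext ((hnodup.getElem_inj_iff).1 h1)

/-- The state reached on a word. -/
noncomputable def stateOf (hR : IsIndistinguishability (recognisedRel R))
    (hb : BoundedBranching hR.setoid) (τ : List (Fin k)) :
    Fin (statesCode (dfaCode R)).length :=
  ⟨indexCode (dfaCode R) (wordCode τ), indexCode_lt hR hb τ⟩

lemma indexedMatrix_stateWord_stateOf (hR : IsIndistinguishability (recognisedRel R))
    (hb : BoundedBranching hR.setoid) (τ : List (Fin k)) :
    indexedMatrix hR (stateWord R (stateOf hR hb τ)) = indexedMatrix hR τ := by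
  rw [← keyCode_eq_iff hR, ← unpair_eq_wordCode_stateWord]
  exact keyCode_getElem_indexCode (indexCode_lt hR hb τ)

lemma stateOf_eq_stateOf_iff (hR : IsIndistinguishability (recognisedRel R))
    (hb : BoundedBranching hR.setoid) {τ τ' : List (Fin k)} :
    stateOf hR hb τ = stateOf hR hb τ' ↔ indexedMatrix hR τ = indexedMatrix hR τ' := by
  rw [← (indexedMatrix_stateWord_injective hR).eq_iff]
  simp only [indexedMatrix_stateWord_stateOf]

lemma stateOf_stateWord (hR : IsIndistinguishability (recognisedRel R))
    (hb : BoundedBranching hR.setoid) (p : Fin (statesCode (dfaCode R)).length) :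
    stateOf hR hb (stateWord R p) = p :=
  indexedMatrix_stateWord_injective hR (indexedMatrix_stateWord_stateOf hR hb _)

lemma length_statesCode_mul_le (hR : IsIndistinguishability (recognisedRel R))
    (hb : BoundedBranching hR.setoid) :
    (statesCode (dfaCode R)).length * k ≤ boundCode (dfaCode R) := by
  rcases Nat.eq_zero_or_pos k with hk | hk
  · exact (Nat.mul_eq_zero.2 (Or.inr hk)).trans_le (Nat.zero_le _)
  · obtain ⟨hfin, hcard, -⟩ := card_range_indexedMatrix_le hR hb (by rwa [Fintype.card_fin])
    simp only [Fintype.card_fin] at hcard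
    refine le_trans (Nat.mul_le_mul_right _ ?_) hcard
    have := Set.ncard_le_ncard (s := Set.range fun p => indexedMatrix hR (stateWord R p))
      (Set.range_subset_iff.2 fun p => Set.mem_range_self _) hfin
    rwa [Set.ncard_range_of_injective (indexedMatrix_stateWord_injective hR),
      Nat.card_fin] at this

lemma outputCode_lt_boundCode (hR : IsIndistinguishability (recognisedRel R))
    (hb : BoundedBranching hR.setoid) (τ : List (Fin k)) (a : Fin k) :
    outputCode (dfaCode R) (wordCode τ) a < boundCode (dfaCode R) := by
  obtain ⟨-, -, hdim⟩ := card_range_indexedMatrix_le hR hb 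
    (by rw [Fintype.card_fin]; exact a.pos)
  simp only [Fintype.card_fin] at hdim
  exact (outputCode_lt hR τ a).trans_le (hdim τ)

/-- The Mealy automaton whose states are the indexed matrices. -/
noncomputable def mealyOf (hR : IsIndistinguishability (recognisedRel R))
    (hb : BoundedBranching hR.setoid) :
    Mealy (Fin k) (Fin (boundCode (dfaCode R))) (Fin (statesCode (dfaCode R)).length) where
  start := stateOf hR hb []
  step p a := stateOf hR hb (stateWord R p ++ [a])
  output p a := ⟨outputCode (dfaCode R) (wordCode (stateWord R p)) a,
    outputCode_lt_boundCode hR hb _ a⟩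

lemma eval_mealyOf (hR : IsIndistinguishability (recognisedRel R))
    (hb : BoundedBranching hR.setoid) (τ : List (Fin k)) :
    (mealyOf hR hb).eval τ = stateOf hR hb τ := by
  induction τ using List.reverseRecOn with
  | nil => rfl
  | append_singleton τ a ih =>
    rw [Mealy.eval] at ih ⊢
    rw [List.foldl_append, ih, List.foldl_cons, List.foldl_nil]
    exact (stateOf_eq_stateOf_iff hR hb).2
      (indexedMatrix_concat hR (indexedMatrix_stateWord_stateOf hR hb τ) a)

lemma construction_dfaCode (hR : IsIndistinguishability (recognisedRel R))
    (hb : BoundedBranching hR.setoid) :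
    construction (dfaCode R) = mealyCode (mealyOf hR hb) := by
  have hk : (dfaCode R).1 = k := rfl
  simp only [construction, mealyCode, hk, Prod.mk.injEq, true_and]
  refine ⟨rfl, ?_, ?_⟩
  · refine List.ext_getElem (by simp) fun i h1 h2 => ?_
    have hi : i < (statesCode (dfaCode R)).length := by simpa using h1
    refine List.ext_getElem (by simp) fun a h3 h4 => ?_
    have ha : a < k := by simpa using h3
    have hp := unpair_eq_wordCode_stateWord (R := R) ⟨i, hi⟩
    simp only [Fin.getElem_fin] at hp
    simp only [List.getElem_map, List.getElem_range, List.getElem_finRange, hp]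
    simp only [mealyOf, stateOf, wordCode, List.length_append, List.length_singleton,
      wordNumber_concat]
    rfl
  · refine List.ext_getElem (by simp) fun i h1 h2 => ?_
    have hi : i < (statesCode (dfaCode R)).length := by simpa using h1
    refine List.ext_getElem (by simp) fun a h3 h4 => ?_
    have ha : a < k := by simpa using h3
    have hp := unpair_eq_wordCode_stateWord (R := R) ⟨i, hi⟩
    simp only [Fin.getElem_fin] at hp
    simp only [List.getElem_map, List.getElem_range, List.getElem_finRange, hp]
    rfl

lemma solvesConstraints_mealyOf (hR : IsIndistinguishability (recognisedRel R))
    (hb : BoundedBranching hR.setoid) :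
    SolvesConstraints R (mealyOf hR hb) fun v => (mealyOf hR hb).output v.1 v.2 := by
  rintro p₁ p₂ q ⟨τ, τ', hlen, rfl, rfl, rfl⟩ hq a b
  have hrel : recognisedRel R τ τ' := (recognisedRel_iff hlen).2 hq
  have hout : ∀ (ρ : List (Fin k)) (c : Fin k), ((mealyOf hR hb).output
      ((mealyOf hR hb).eval ρ) c : ℕ) = outputCode (dfaCode R) (wordCode ρ) c := fun ρ c => by
    rw [eval_mealyOf]
    exact outputCode_congr hR (indexedMatrix_stateWord_stateOf hR hb ρ) c
  have key : (mealyOf hR hb).output ((mealyOf hR hb).eval τ) a =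
      (mealyOf hR hb).output ((mealyOf hR hb).eval τ') b ↔
        R.step (R.eval (τ.zip τ')) (a, b) ∈ R.accept := by
    rw [Fin.ext_iff, hout, hout, outputCode_eq_iff hR hrel, recognisedRel_iff (by simp [hlen]),
      eval_zip_concat hlen]
  exact ⟨key.2, fun h heq => h (key.1 heq)⟩

end States

/-! ### Observation histories -/

section Observation

variable {Γ S P Q : Type*} {R : DFA (Γ × Γ) Q}

lemma length_observationHistory (β : List Γ → Γ → S) (τ : List Γ) :
    (observationHistory β τ).length = τ.length := List.length_ofFn

lemma getElem_observationHistory (β : List Γ → Γ → S) (τ : List Γ) (i : ℕ)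
    (h : i < (observationHistory β τ).length) :
    (observationHistory β τ)[i] =
      β (τ.take i) (τ[i]'(h.trans_eq (length_observationHistory β τ))) :=
  List.getElem_ofFn h

lemma observationHistory_concat (β : List Γ → Γ → S) (τ : List Γ) (a : Γ) :
    observationHistory β (τ ++ [a]) = observationHistory β τ ++ [β τ a] := by
  refine List.ext_getElem (by simp [length_observationHistory]) fun i h1 h2 => ?_
  rw [getElem_observationHistory]
  rw [length_observationHistory, List.length_append, List.length_singleton] at h1
  rcases Nat.lt_or_ge i τ.length with hi | hi
  · have hi' : i < (observationHistory β τ).length := by rwa [length_observationHistory]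
    rw [List.getElem_append_left hi',
      getElem_observationHistory, List.getElem_append_left hi,
      List.take_append_of_le_length hi.le]
  · obtain rfl : i = τ.length := by omega
    simp [length_observationHistory]

/-- A solution of the constraints makes the observation histories agree exactly on related
histories. -/
lemma SolvesConstraints.recognisedRel_iff (hR : IsIndistinguishability (recognisedRel R))
    {M : Mealy Γ S P} (hM : SolvesConstraints R M fun v => M.output v.1 v.2) (τ τ' : List Γ) :
    recognisedRel R τ τ' ↔
      observationHistory M.observation τ = observationHistory M.observation τ' := by
  induction τ using List.reverseRecOn generalizing τ' with
  | nil =>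
    constructor
    · intro h
      rw [List.length_eq_zero_iff.1 h.1.symm]
    · intro h
      have := congrArg List.length h
      simp only [length_observationHistory, List.length_nil] at this
      rw [List.length_eq_zero_iff.1 this.symm]
      exact hR.equivalence.refl _
  | append_singleton τ a ih =>
    rcases List.eq_nil_or_concat τ' with rfl | ⟨τ', b, rfl⟩
    · refine iff_of_false (fun h => by simpa using h.1) fun h => ?_
      simpa [observationHistory] using congrArg List.length h
    rw [List.concat_eq_append, observationHistory_concat, observationHistory_concat,
      List.append_singleton_inj]
    have key : recognisedRel R τ τ' → (M.observation τ a = M.observation τ' b ↔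
        recognisedRel R (τ ++ [a]) (τ' ++ [b])) := by
      intro hrel
      rw [InfoAutomata.recognisedRel_iff (by simp [hrel.1]), eval_zip_concat hrel.1]
      have := hM _ _ _ ⟨τ, τ', hrel.1, rfl, rfl, rfl⟩
        ((InfoAutomata.recognisedRel_iff hrel.1).1 hrel) a b
      exact ⟨fun h => by_contra fun hn => this.2 hn h, this.1⟩
    constructor
    · intro h
      have hrel := recognisedRel_of_append hR (by simpa using h.1) h
      exact ⟨(ih τ').1 hrel, (key hrel).2 h⟩
    · rintro ⟨h1, h2⟩
      exact (key ((ih τ').2 h1)).1 h2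

end Observation

end InfoAutomata

open InfoAutomata

theorem mainTheorem3 :
    ∃ (C : ℕ) (construct : DFACode → MealyCode), Computable construct ∧
      ∀ (k n : ℕ) (R : DFA (Fin k × Fin k) (Fin n))
        (hR : IsIndistinguishability (recognisedRel R)),
        BoundedBranching hR.setoid →
        ∃ (N s : ℕ) (M : Mealy (Fin k) (Fin s) (Fin N)),
          construct (dfaCode R) = mealyCode M ∧
          M.size ≤ 2 ^ (2 ^ (2 ^ (C * dfaSize R ^ 2))) ∧
          (∀ τ τ' : List (Fin k), recognisedRel R τ τ' ↔
            observationHistory M.observation τ = observationHistory M.observation τ') ∧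
          (∀ p : Fin N, ∃ τ : List (Fin k), M.eval τ = p) ∧
          (∃ label : Fin N → IndexedMatrix (MinState R), Function.Injective label ∧
            ∀ τ : List (Fin k), IsIndexedMatrixOf R τ (label (M.eval τ))) ∧
          SolvesConstraints R M (fun v => M.output v.1 v.2) := by
  refine ⟨11, construction, primrec_construction.to_comp, fun k n R hR hb =>
    ⟨_, _, mealyOf hR hb, construction_dfaCode hR hb, ?_,
      (solvesConstraints_mealyOf hR hb).recognisedRel_iff hR,
      fun p => ⟨stateWord R p, (eval_mealyOf hR hb _).trans (stateOf_stateWord hR hb p)⟩,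
      ⟨fun p => indexedMatrix hR (stateWord R p), indexedMatrix_stateWord_injective hR,
        fun τ => ?_⟩, solvesConstraints_mealyOf hR hb⟩⟩
  · have h := length_statesCode_mul_le hR hb
    rw [boundCode_dfaCode] at h
    simpa only [Mealy.size, dfaSize, Fintype.card_prod, Fintype.card_fin] using h
  · rw [eval_mealyOf]
    beta_reduce
    rw [indexedMatrix_stateWord_stateOf]
    exact isIndexedMatrixOf_indexedMatrix hR τ
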